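/- Let $1\le p<\infty$, let $J^+$ and $J^-$ be finite index sets, and let $\mathbf X_p=(L^p(0,1))^{J^+}\times(L^p(0,1))^{J^-}$ (real- or complex-valued functions), whose elements are written $\Phi=\binom{\upsilon}{\varpi}$ with $\upsilon=(\upsilon_j)_{j\in J^+}$ and $\varpi=(\varpi_j)_{j\in J^-}$. Let $\mathcal B$ be an arbitrary square matrix with scalar entries indexed by the disjoint union $J^+\sqcup J^-$, and write any such matrix in blocks $M=\begin{pmatrix}M^{11}&M^{12}\\M^{21}&M^{22}\end{pmatrix}$ accordingly. Define the operator $A$ in $\mathbf X_p$ by $$A\binom{\upsilon}{\varpi}=\binom{-\upsilon'}{\varpi'},\qquad D(A)=\left\{\binom{\upsilon}{\varpi}\in (W^{1,p}(0,1))^{J^+}\times(W^{1,p}(0,1))^{J^-}:\ \binom{\upsilon(0)}{\varpi(1)}=\mathcal B\binom{\upsilon(1)}{\varpi(0)}\right\}.$$ For $t\ge 0$, $\Phi=\binom{\upsilon}{\varpi}\in\mathbf X_p$, almost every $x\in(0,1)$ and $n\in\{0,1,2,\dots\}$ put $$(T(t)\Phi)^+(x)=(\mathcal B^n)^{11}\upsilon(n-t+x)+(\mathcal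 B^n)^{12}\varpi(1-n+t-x)\quad\text{if } n-1+x<t<n+x,$$ $$(T(t)\Phi)^-(x)=(\mathcal B^n)^{21}\upsilon(1-t+n-x)+(\mathcal B^n)^{22}\varpi(t-n+x)\quad\text{if } n-x<t<n+1-x.$$ Then these formulas define a unique family $(T(t))_{t\ge0}$ of bounded linear operators on $\mathbf X_p$; this family is a $C_0$-semigroup, and its generator is $(A,D(A))$. Consequently, if $(G(t))_{t\ge0}$ denotes the $C_0$-semigroup generated by $(A,D(A))$, then $T(t)=G(t)$ for all $t\ge0$. -/

import Mathlib

open MeasureTheory Set Filter Topology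
open scoped NNReal ENNReal ContDiff Matrix

noncomputable section

namespace PortHam

/-! ### Strongly continuous semigroups and their generators -/

section Semigroup

variable {𝕜 : Type*} [RCLike 𝕜] {X : Type*} [NormedAddCommGroup X] [NormedSpace 𝕜 X]

/-- A family of bounded linear operators `T t`, `t ≥ 0`, is a `C₀`-semigroup if `T 0 = I`,
`T (s + t) = T s T t`, and all orbits `t ↦ T t x` are continuous. -/
structure IsC0Semigroup (T : ℝ≥0 → (X →L[𝕜] X)) : Prop where
  map_zero : T 0 = ContinuousLinearMap.id 𝕜 X
  map_add : ∀ s t : ℝ≥0, T (s + t) = (T s).comp (T t)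
  continuous_orbit : ∀ x : X, Continuous fun t => T t x

/-- `y` is the limit of `h⁻¹ (T h x - x)` as `h → 0+`. -/
def HasGeneratorValue (T : ℝ≥0 → (X →L[𝕜] X)) (x y : X) : Prop :=
  Tendsto (fun h : ℝ≥0 => (((h : ℝ)⁻¹ : ℝ) : 𝕜) • (T h x - x)) (𝓝[>] 0) (𝓝 y)

theorem HasGeneratorValue.unique {T : ℝ≥0 → (X →L[𝕜] X)} {x y z : X}
    (hy : HasGeneratorValue T x y) (hz : HasGeneratorValue T x z) : y = z :=
  tendsto_nhds_unique hy hz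

theorem HasGeneratorValue.add {T : ℝ≥0 → (X →L[𝕜] X)} {x x' y y' : X}
    (h : HasGeneratorValue T x y) (h' : HasGeneratorValue T x' y') :
    HasGeneratorValue T (x + x') (y + y') := by
  refine (Tendsto.add h h').congr fun t => ?_
  rw [← smul_add, _root_.map_add]
  congr 1
  abel

theorem HasGeneratorValue.smul {T : ℝ≥0 → (X →L[𝕜] X)} {x y : X} (c : 𝕜)
    (h : HasGeneratorValue T x y) : HasGeneratorValue T (c • x) (c • y) := by
  refine (Tendsto.const_smul h c).congr fun t => ?_
  rw [_root_.map_smul, ← smul_sub, smul_comm]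

theorem HasGeneratorValue.zero (T : ℝ≥0 → (X →L[𝕜] X)) : HasGeneratorValue T 0 0 := by
  simp [HasGeneratorValue]

/-- The (infinitesimal) generator of a family `T` of bounded operators: the unbounded operator
whose domain consists of all `x` for which `lim_{h → 0+} h⁻¹ (T h x - x)` exists, and whose value
at such an `x` is this limit. -/
def generator (T : ℝ≥0 → (X →L[𝕜] X)) : X →ₗ.[𝕜] X where
  domain :=
    { carrier := {x | ∃ y, HasGeneratorValue T x y}
      add_mem' := fun ⟨_, ha⟩ ⟨_, hb⟩ => ⟨_, ha.add hb⟩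
      zero_mem' := ⟨0, HasGeneratorValue.zero T⟩
      smul_mem' := fun c _ ⟨_, ha⟩ => ⟨_, ha.smul c⟩ }
  toFun :=
    { toFun := fun x => Classical.choose x.2
      map_add' := fun x y =>
        (Classical.choose_spec (x + y).2).unique
          ((Classical.choose_spec x.2).add (Classical.choose_spec y.2))
      map_smul' := fun c x =>
        (Classical.choose_spec (c • x).2).unique ((Classical.choose_spec x.2).smul c) }

end Semigroup

/-! ### The space `L^p(0,1)` and its Sobolev subspace `W^{1,p}(0,1)` -/

/-- Lebesgue measure on the interval `(0,1)`. -/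
abbrev unitMeasure : Measure ℝ := volume.restrict (Ioo (0 : ℝ) 1)

/-- `L^p(0,1)` with values in `𝕜 = ℝ` or `ℂ`. -/
abbrev Lp01 (𝕜 : Type*) [RCLike 𝕜] (p : ℝ≥0∞) := Lp 𝕜 p unitMeasure

section Sobolev

variable {𝕜 : Type*} [RCLike 𝕜] {p : ℝ≥0∞}

/-- `g` is the weak derivative of `f` on `(0,1)`. -/
def HasWeakDeriv (f g : Lp01 𝕜 p) : Prop :=
  ∀ φ : ℝ → ℝ, ContDiff ℝ ∞ φ → HasCompactSupport φ → tsupport φ ⊆ Ioo (0 : ℝ) 1 →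
    ∫ x in Ioo (0 : ℝ) 1, deriv φ x • f x = -∫ x in Ioo (0 : ℝ) 1, φ x • g x

theorem integrable_lp01 [Fact (1 ≤ p)] (f : Lp01 𝕜 p) : Integrable f unitMeasure :=
  (Lp.memLp f).integrable Fact.out

theorem integrable_smul_lp01 [Fact (1 ≤ p)] {φ : ℝ → ℝ} (hφ : Continuous φ)
    (hc : HasCompactSupport φ) (f : Lp01 𝕜 p) :
    Integrable (fun x => φ x • f x) unitMeasure := by
  obtain ⟨C, hC⟩ := hc.exists_bound_of_continuous hφ
  exact (integrable_lp01 f).bdd_smul C hφ.aestronglyMeasurable (ae_of_all _ hC)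

theorem HasWeakDeriv.zero : HasWeakDeriv (0 : Lp01 𝕜 p) 0 := by
  intro φ _ _ _
  have h0 : ((0 : Lp01 𝕜 p) : ℝ → 𝕜) =ᵐ[unitMeasure] 0 := Lp.coeFn_zero _ _ _
  rw [integral_congr_ae (g := fun _ => (0 : 𝕜)) (by filter_upwards [h0] with x hx; rw [hx, Pi.zero_apply, smul_zero]),
    integral_congr_ae (f := fun x => φ x • ((0 : Lp01 𝕜 p) : ℝ → 𝕜) x) (g := fun _ => (0 : 𝕜))
      (by filter_upwards [h0] with x hx; rw [hx, Pi.zero_apply, smul_zero])]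
  simp

theorem HasWeakDeriv.add [Fact (1 ≤ p)] {f f' g g' : Lp01 𝕜 p}
    (h : HasWeakDeriv f g) (h' : HasWeakDeriv f' g') : HasWeakDeriv (f + f') (g + g') := by
  intro φ h1 h2 h3
  have key : ∀ (ψ : ℝ → ℝ), Continuous ψ → HasCompactSupport ψ → ∀ a b : Lp01 𝕜 p,
      ∫ x in Ioo (0 : ℝ) 1, ψ x • ((a + b : Lp01 𝕜 p) : ℝ → 𝕜) x =
        (∫ x in Ioo (0 : ℝ) 1, ψ x • a x) + ∫ x in Ioo (0 : ℝ) 1, ψ x • b x := by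
    intro ψ hψ hc a b
    rw [← integral_add (integrable_smul_lp01 hψ hc a) (integrable_smul_lp01 hψ hc b)]
    refine integral_congr_ae ?_
    filter_upwards [Lp.coeFn_add a b] with x hx
    rw [hx, Pi.add_apply, smul_add]
  rw [key _ (h1.continuous_deriv (by simp)) h2.deriv, key _ h1.continuous h2, h φ h1 h2 h3,
    h' φ h1 h2 h3, neg_add]

theorem HasWeakDeriv.smul (c : 𝕜) {f g : Lp01 𝕜 p} (h : HasWeakDeriv f g) :
    HasWeakDeriv (c • f) (c • g) := by
  intro φ h1 h2 h3
  have key : ∀ (ψ : ℝ → ℝ) (a : Lp01 𝕜 p),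
      ∫ x in Ioo (0 : ℝ) 1, ψ x • ((c • a : Lp01 𝕜 p) : ℝ → 𝕜) x =
        c • ∫ x in Ioo (0 : ℝ) 1, ψ x • a x := by
    intro ψ a
    rw [← integral_smul]
    refine integral_congr_ae ?_
    filter_upwards [Lp.coeFn_smul c a] with x hx
    rw [hx, Pi.smul_apply, smul_comm]
  rw [key, key, h φ h1 h2 h3, smul_neg]

theorem HasWeakDeriv.unique [Fact (1 ≤ p)] {f g g' : Lp01 𝕜 p}
    (h : HasWeakDeriv f g) (h' : HasWeakDeriv f g') : g = g' := by
  have hint : IntegrableOn (fun x => g x - g' x) (Ioo (0 : ℝ) 1) volume :=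
    (integrable_lp01 g).sub (integrable_lp01 g')
  have := isOpen_Ioo.ae_eq_zero_of_integral_contDiff_smul_eq_zero (μ := volume)
    (U := Ioo (0 : ℝ) 1) (f := fun x => g x - g' x) hint.locallyIntegrableOn ?_
  · refine Lp.ext ?_
    refine (ae_restrict_iff' measurableSet_Ioo).2 ?_
    filter_upwards [this] with x hx hxU
    exact sub_eq_zero.1 (hx hxU)
  · intro φ h1 h2 h3
    have e : ∫ x in Ioo (0 : ℝ) 1, φ x • (g x - g' x) = 0 := by
      simp_rw [smul_sub]
      rw [integral_sub (integrable_smul_lp01 h1.continuous h2 g)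
        (integrable_smul_lp01 h1.continuous h2 g'), sub_eq_zero]
      exact neg_injective ((h φ h1 h2 h3).symm.trans (h' φ h1 h2 h3))
    rw [← e]
    refine (setIntegral_eq_integral_of_forall_compl_eq_zero fun x hx => ?_).symm
    rw [image_eq_zero_of_notMem_tsupport fun hx' => hx (h3 hx'), zero_smul]

variable (𝕜 p) in
/-- The Sobolev space `W^{1,p}(0,1)`: all `f ∈ L^p(0,1)` with a weak derivative in `L^p(0,1)`. -/
def W1p [Fact (1 ≤ p)] : Submodule 𝕜 (Lp01 𝕜 p) where
  carrier := {f | ∃ g, HasWeakDeriv f g}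
  add_mem' := fun ⟨_, ha⟩ ⟨_, hb⟩ => ⟨_, ha.add hb⟩
  zero_mem' := ⟨0, HasWeakDeriv.zero⟩
  smul_mem' := fun c _ ⟨_, ha⟩ => ⟨_, ha.smul c⟩

/-- The weak derivative as a linear map `W^{1,p}(0,1) → L^p(0,1)`. -/
def weakDeriv [Fact (1 ≤ p)] : W1p 𝕜 p →ₗ[𝕜] Lp01 𝕜 p where
  toFun f := Classical.choose f.2
  map_add' f g := (Classical.choose_spec (f + g).2).unique
    ((Classical.choose_spec f.2).add (Classical.choose_spec g.2))
  map_smul' c f := (Classical.choose_spec (c • f).2).unique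
    ((Classical.choose_spec f.2).smul c)

/-- `F` is, on `[0,1]`, the continuous representative of `f`. It is unique on `[0,1]`, and exists
for every `f ∈ W^{1,p}(0,1)`; the boundary values of `f` are `F 0` and `F 1`. -/
def IsContRep (F : ℝ → 𝕜) (f : Lp01 𝕜 p) : Prop :=
  ContinuousOn F (Icc 0 1) ∧ f =ᵐ[unitMeasure] F

end Sobolev

/-! ### The state space, the operator `A`, and the explicit formula -/

/-- The space `X_p = (L^p(0,1))^{J⁺} × (L^p(0,1))^{J⁻}` with its `p`-norm. The components
`Φ (Sum.inl j)` form `Φ⁺ = υ`, and the components `Φ (Sum.inr j)` form `Φ⁻ = ϖ`. -/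
abbrev StateSpace (𝕜 : Type*) [RCLike 𝕜] (p : ℝ≥0∞) (Jp Jm : Type*) :=
  PiLp p (fun _ : Jp ⊕ Jm => Lp01 𝕜 p)

section System

variable {𝕜 : Type*} [RCLike 𝕜] (p : ℝ≥0∞) [Fact (1 ≤ p)]
  {Jp Jm : Type*} [Fintype Jp] [Fintype Jm]

/-- The boundary condition `(υ(0), ϖ(1)) = B (υ(1), ϖ(0))`, for (continuous) functions
`F = (υ, ϖ)` on `[0,1]`. -/
def BoundaryCondition (B : Matrix (Jp ⊕ Jm) (Jp ⊕ Jm) 𝕜) (F : Jp ⊕ Jm → ℝ → 𝕜) : Prop :=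
  Sum.elim (fun j => F (Sum.inl j) 0) (fun j => F (Sum.inr j) 1) =
    B *ᵥ Sum.elim (fun j => F (Sum.inl j) 1) (fun j => F (Sum.inr j) 0)

/-- The domain `D(A) = {(υ, ϖ) ∈ W^{1,p} : (υ(0), ϖ(1)) = B (υ(1), ϖ(0))}`. -/
def domainA (B : Matrix (Jp ⊕ Jm) (Jp ⊕ Jm) 𝕜) : Submodule 𝕜 (StateSpace 𝕜 p Jp Jm) where
  carrier := {Φ | (∀ j, Φ j ∈ W1p 𝕜 p) ∧
    ∃ F : Jp ⊕ Jm → ℝ → 𝕜, (∀ j, IsContRep (F j) (Φ j)) ∧ BoundaryCondition B F}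
  add_mem' := by
    rintro Φ Ψ ⟨h1, F, hF, hB⟩ ⟨h2, G, hG, hB'⟩
    refine ⟨fun j => (W1p 𝕜 p).add_mem (h1 j) (h2 j), fun j => F j + G j, fun j => ?_, ?_⟩
    · refine ⟨(hF j).1.add (hG j).1, ?_⟩
      exact (Lp.coeFn_add (Φ j) (Ψ j)).trans ((hF j).2.add (hG j).2)
    · unfold BoundaryCondition at *
      have e := congrArg₂ (· + ·) hB hB'
      simp only [← Matrix.mulVec_add] at e
      convert e using 2 <;> ext (j | j) <;> simp
  zero_mem' := by
    refine ⟨fun j => (W1p 𝕜 p).zero_mem, fun _ => 0, fun j => ?_, ?_⟩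
    · exact ⟨continuousOn_const, Lp.coeFn_zero _ _ _⟩
    · unfold BoundaryCondition
      have e : ∀ f : Jp ⊕ Jm → 𝕜, f = 0 → f = B *ᵥ f := by
        rintro f rfl; simp
      exact e _ (by ext (j | j) <;> simp)
  smul_mem' := by
    rintro c Φ ⟨h1, F, hF, hB⟩
    refine ⟨fun j => (W1p 𝕜 p).smul_mem c (h1 j), fun j => c • F j, fun j => ?_, ?_⟩
    · refine ⟨(hF j).1.const_smul c, ?_⟩
      exact (Lp.coeFn_smul c (Φ j)).trans ((hF j).2.const_smul c)
    · unfold BoundaryCondition at *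
      have e := congrArg (c • ·) hB
      simp only [← Matrix.mulVec_smul] at e
      convert e using 2 <;> ext (j | j) <;> simp

/-- The operator `A (υ, ϖ) = (-υ', ϖ')` with domain `D(A)` (unit velocities). -/
def operatorA (B : Matrix (Jp ⊕ Jm) (Jp ⊕ Jm) 𝕜) :
    StateSpace 𝕜 p Jp Jm →ₗ.[𝕜] StateSpace 𝕜 p Jp Jm where
  domain := domainA p B
  toFun :=
    { toFun := fun Φ => WithLp.toLp p (Sum.elim
        (fun j => -weakDeriv ⟨Φ.1 (Sum.inl j), Φ.2.1 (Sum.inl j)⟩)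
        (fun j => weakDeriv ⟨Φ.1 (Sum.inr j), Φ.2.1 (Sum.inr j)⟩))
      map_add' := by
        intro Φ Ψ
        ext1 (j | j)
        · exact (congrArg Neg.neg (weakDeriv.map_add ⟨Φ.1 (Sum.inl j), Φ.2.1 (Sum.inl j)⟩
            ⟨Ψ.1 (Sum.inl j), Ψ.2.1 (Sum.inl j)⟩)).trans (neg_add _ _)
        · exact weakDeriv.map_add ⟨Φ.1 (Sum.inr j), Φ.2.1 (Sum.inr j)⟩
            ⟨Ψ.1 (Sum.inr j), Ψ.2.1 (Sum.inr j)⟩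
      map_smul' := by
        intro c Φ
        ext1 (j | j)
        · exact (congrArg Neg.neg (weakDeriv.map_smul c
            ⟨Φ.1 (Sum.inl j), Φ.2.1 (Sum.inl j)⟩)).trans (smul_neg _ _).symm
        · exact weakDeriv.map_smul c ⟨Φ.1 (Sum.inr j), Φ.2.1 (Sum.inr j)⟩ }

variable {p}

/-- The family `T` is given by the method-of-characteristics formula: for all `t ≥ 0`, all initial
data `Φ = (υ, ϖ)`, almost all `x ∈ (0,1)` and all `n ∈ ℕ`,
`(T(t)Φ)⁺(x) = (Bⁿ)¹¹ υ(n - t + x) + (Bⁿ)¹² ϖ(1 - n + t - x)` if `n - 1 + x < t < n + x`, and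
`(T(t)Φ)⁻(x) = (Bⁿ)²¹ υ(1 - t + n - x) + (Bⁿ)²² ϖ(t - n + x)` if `n - x < t < n + 1 - x`. -/
def IsCharacteristicsFamily [DecidableEq Jp] [DecidableEq Jm]
    (B : Matrix (Jp ⊕ Jm) (Jp ⊕ Jm) 𝕜)
    (T : ℝ≥0 → (StateSpace 𝕜 p Jp Jm →L[𝕜] StateSpace 𝕜 p Jp Jm)) : Prop :=
  ∀ (t : ℝ≥0) (Φ : StateSpace 𝕜 p Jp Jm), ∀ᵐ x ∂unitMeasure, ∀ n : ℕ,
    ((n : ℝ) - 1 + x < t ∧ (t : ℝ) < n + x →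
      (fun j => T t Φ (Sum.inl j) x) =
        (B ^ n).toBlocks₁₁ *ᵥ (fun k => Φ (Sum.inl k) (n - t + x)) +
        (B ^ n).toBlocks₁₂ *ᵥ (fun k => Φ (Sum.inr k) (1 - n + t - x))) ∧
    ((n : ℝ) - x < t ∧ (t : ℝ) < n + 1 - x →
      (fun j => T t Φ (Sum.inr j) x) =
        (B ^ n).toBlocks₂₁ *ᵥ (fun k => Φ (Sum.inl k) (1 - t + n - x)) +
        (B ^ n).toBlocks₂₂ *ᵥ (fun k => Φ (Sum.inr k) (t - n + x)))

end System

end PortHam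

end

noncomputable section

namespace PortHam

/-! ### General facts on strongly continuous semigroups -/

section Abstract

variable {𝕜 : Type*} [RCLike 𝕜] {X : Type*} [NormedAddCommGroup X] [NormedSpace 𝕜 X]
  {T G : ℝ≥0 → (X →L[𝕜] X)} {x y : X}

/-! Reflecting the left-moving components by x ↦ 1 - x turns the system into pure transport to the
right, w' = -∂ₓw on (0,1) with w(0) = B w(1). To solve it, extend w to the left by w(y) = B w(y + 1)
and translate by t. Cutting the extension into unit intervals gives `flow`, a finite sum of terms Bⁿ
shift(t - n). Strong continuity comes from continuity of translations in L^p for p < ∞, and the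
semigroup law from additivity of the exponents (`coeFn_flow`, `isC0Semigroup_flow`).

The generator is found without resolvents. A pair (w, y) lies in its graph iff T(s)w - w = ∫₀ˢ T(r)y
dr for small s, and for s ≤ 1 both sides are explicit: only n = 0, 1 contribute, and integrals of
shifts are differences of primitives. Weak derivative -y and the boundary condition give this
identity (`hasGeneratorValue_flow_of_boundary`). Conversely, pairing the difference quotient with
test functions gives the weak derivative -y, and the identity at s = 1/2 then forces the boundary
condition (`HasGeneratorValue.hasWeakDeriv_flow`, `HasGeneratorValue.boundary_flow`).

The formulas determine T because the intervals for t indexed by n cover almost every x. Equality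
with G follows since a C₀-semigroup is determined by its generator. -/

theorem IsC0Semigroup.exists_bound [CompleteSpace X] (hT : IsC0Semigroup T) (b : ℝ≥0) :
    ∃ C : ℝ, ∀ t ≤ b, ‖T t‖ ≤ C := by
  obtain ⟨C, hC⟩ := banach_steinhaus (g := fun t : Icc (0 : ℝ≥0) b => T t) fun x => by
    obtain ⟨C, hC⟩ := isCompact_Icc.exists_bound_of_continuousOn (s := Icc (0 : ℝ≥0) b)
      (hT.continuous_orbit x).continuousOn
    exact ⟨C, fun t => hC t t.2⟩
  exact ⟨C, fun t ht => hC ⟨t, zero_le, ht⟩⟩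

theorem IsC0Semigroup.continuous_orbit_toNNReal (hT : IsC0Semigroup T) (x : X) :
    Continuous fun r : ℝ => T r.toNNReal x :=
  (hT.continuous_orbit x).comp continuous_real_toNNReal

theorem IsC0Semigroup.apply_add (hT : IsC0Semigroup T) (s t : ℝ≥0) (x : X) :
    T (s + t) x = T s (T t x) := by
  rw [hT.map_add]; rfl

theorem IsC0Semigroup.apply_zero (hT : IsC0Semigroup T) (x : X) : T 0 x = x := by
  rw [hT.map_zero]; rfl

theorem IsC0Semigroup.apply_comm (hT : IsC0Semigroup T) (s t : ℝ≥0) (x : X) :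
    T s (T t x) = T t (T s x) := by
  rw [← hT.apply_add, add_comm, hT.apply_add]

/-- Operators that are bounded near a filter may be evaluated along a convergent family. -/
theorem tendsto_apply_of_bounded {ι : Type*} {l : Filter ι} {A : ι → X →L[𝕜] X} {u : ι → X}
    {C : ℝ} {a z : X} (hA : ∀ᶠ i in l, ‖A i‖ ≤ C) (hu : Tendsto u l (𝓝 a))
    (hz : Tendsto (fun i => A i a) l (𝓝 z)) : Tendsto (fun i => A i (u i)) l (𝓝 z) := by
  have h1 : Tendsto (fun i => A i (u i - a)) l (𝓝 0) := by
    have h2 : Tendsto (fun i => C * ‖u i - a‖) l (𝓝 0) := by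
      have := (tendsto_iff_norm_sub_tendsto_zero.1 hu).const_mul C
      rwa [mul_zero] at this
    refine squeeze_zero_norm' ?_ h2
    filter_upwards [hA] with i hi
    exact (A i).le_of_opNorm_le hi _
  simpa using h1.add hz

theorem HasGeneratorValue.apply (hT : IsC0Semigroup T) (h : HasGeneratorValue T x y) (s : ℝ≥0) :
    HasGeneratorValue T (T s x) (T s y) := by
  refine (((T s).continuous.tendsto y).comp h).congr fun r => ?_
  simp only [Function.comp_apply, _root_.map_smul, _root_.map_sub, hT.apply_comm s r]

theorem hasGeneratorValue_generator (x : (generator T).domain) :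
    HasGeneratorValue T x (generator T x) := Classical.choose_spec x.2

theorem hasGeneratorValue_iff_generator :
    HasGeneratorValue T x y ↔ ∃ h : x ∈ (generator T).domain, generator T ⟨x, h⟩ = y :=
  ⟨fun h => ⟨⟨y, h⟩, (hasGeneratorValue_generator ⟨x, ⟨y, h⟩⟩).unique h⟩,
    fun ⟨h, e⟩ => e ▸ hasGeneratorValue_generator ⟨x, h⟩⟩

theorem HasGeneratorValue.of_generator_eq (h : generator T = generator G)
    (hx : HasGeneratorValue T x y) : HasGeneratorValue G x y := by
  rw [hasGeneratorValue_iff_generator] at hx ⊢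
  rwa [← h]

variable [NormedSpace ℝ X]

theorem IsC0Semigroup.tendsto_average [CompleteSpace X] (hT : IsC0Semigroup T) (x : X) (a : ℝ) :
    Tendsto (fun h : ℝ => h⁻¹ • ∫ r in a..(a + h), T r.toNNReal x) (𝓝[>] 0)
      (𝓝 (T a.toNNReal x)) := by
  have h := (intervalIntegral.integral_hasDerivAt_right
    ((hT.continuous_orbit_toNNReal x).intervalIntegrable a a)
    (hT.continuous_orbit_toNNReal x).stronglyMeasurable.stronglyMeasurableAtFilter
    (hT.continuous_orbit_toNNReal x).continuousAt)
  have h2 := hasDerivAt_iff_tendsto_slope_zero.1 h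
  refine (h2.mono_left (nhdsWithin_mono _ fun z (hz : 0 < z) => hz.ne')).congr fun t => ?_
  simp

variable [IsScalarTower ℝ 𝕜 X]

/-- Orbits are differentiated and integrated over ℝ. The coercion from `ℝ≥0` carries one right
neighbourhood filter of 0 to the other, and the scalar tower identifies the two actions on X. -/
theorem hasGeneratorValue_iff_real :
    HasGeneratorValue T x y ↔
      Tendsto (fun h : ℝ => h⁻¹ • (T h.toNNReal x - x)) (𝓝[>] 0) (𝓝 y) := by
  have e : (𝓝[>] (0 : ℝ≥0)).map ((↑) : ℝ≥0 → ℝ) = 𝓝[>] (0 : ℝ) := by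
    have h1 := NNReal.isEmbedding_coe.map_nhdsWithin_eq (Ioi 0) 0
    have h2 : ((↑) : ℝ≥0 → ℝ) '' Ioi 0 = Ioi 0 := by
      ext r
      constructor
      · rintro ⟨s, hs, rfl⟩
        exact NNReal.coe_pos.2 hs
      · intro hr
        exact ⟨⟨r, le_of_lt hr⟩, NNReal.coe_pos.1 hr, rfl⟩
    rwa [h2] at h1
  rw [← e, tendsto_map'_iff]
  unfold HasGeneratorValue
  refine tendsto_congr fun h => ?_
  simp only [Function.comp_apply, Real.toNNReal_coe]
  rw [← RCLike.real_smul_eq_coe_smul]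

theorem HasGeneratorValue.hasDerivWithinAt (hT : IsC0Semigroup T) (h : HasGeneratorValue T x y)
    {s : ℝ} (hs : 0 ≤ s) :
    HasDerivWithinAt (fun r : ℝ => T r.toNNReal x) (T s.toNNReal y) (Ioi s) s := by
  rw [hasDerivWithinAt_iff_tendsto_slope' (by simp)]
  have h1 := hasGeneratorValue_iff_real.1 (h.apply hT s.toNNReal)
  have h2 : Tendsto (fun r : ℝ => r - s) (𝓝[>] s) (𝓝[>] 0) := by
    refine tendsto_nhdsWithin_iff.2 ⟨?_, ?_⟩
    · have : Continuous fun r : ℝ => r - s := by fun_prop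
      have := this.tendsto s
      rw [sub_self] at this
      exact this.mono_left nhdsWithin_le_nhds
    · filter_upwards [self_mem_nhdsWithin] with r hr
      exact sub_pos.2 (mem_Ioi.1 hr)
  refine (h1.comp h2).congr' ?_
  filter_upwards [self_mem_nhdsWithin] with r hr
  have hr' : s < r := hr
  rw [slope_def_module, Function.comp_apply, ← hT.apply_add,
    ← Real.toNNReal_add (by linarith) hs, sub_add_cancel]

variable [CompleteSpace X]

/-- Only right derivatives of orbits are at hand, but a continuous function with a continuous right
derivative is its integral. With the next lemma this characterises the generator by an integral
identity. -/
theorem HasGeneratorValue.sub_eq_integral (hT : IsC0Semigroup T) (h : HasGeneratorValue T x y)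
    {s : ℝ} (hs : 0 ≤ s) : T s.toNNReal x - x = ∫ r in (0 : ℝ)..s, T r.toNNReal y := by
  rw [intervalIntegral.integral_eq_sub_of_hasDeriv_right_of_le hs
    (hT.continuous_orbit_toNNReal x).continuousOn
    (fun r hr => h.hasDerivWithinAt hT hr.1.le)
    ((hT.continuous_orbit_toNNReal y).intervalIntegrable _ _)]
  simp [hT.apply_zero]

theorem IsC0Semigroup.hasGeneratorValue_of_sub_eq_integral (hT : IsC0Semigroup T)
    (h : ∀ s : ℝ, 0 < s → s < 1 → T s.toNNReal x - x = ∫ r in (0 : ℝ)..s, T r.toNNReal y) :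
    HasGeneratorValue T x y := by
  rw [hasGeneratorValue_iff_real]
  have h1 := hT.tendsto_average y 0
  rw [Real.toNNReal_zero, hT.apply_zero] at h1
  refine h1.congr' ?_
  filter_upwards [Ioo_mem_nhdsGT (zero_lt_one' ℝ)] with s hs
  rw [h s hs.1 hs.2, zero_add]

/-- Applying T(h) shifts the domain of integration, so the increment of the integral is ∫ over (s, s
+ h) minus ∫ over (0, h). Divided by h, these are averages with known limits. -/
theorem IsC0Semigroup.hasGeneratorValue_integral (hT : IsC0Semigroup T) (x : X) {s : ℝ}
    (hs : 0 < s) :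
    HasGeneratorValue T (∫ r in (0 : ℝ)..s, T r.toNNReal x) (T s.toNNReal x - x) := by
  rw [hasGeneratorValue_iff_real]
  have h0 := hT.tendsto_average x 0
  rw [Real.toNNReal_zero, hT.apply_zero] at h0
  refine ((hT.tendsto_average x s).sub h0).congr' ?_
  have hi := fun a b => (hT.continuous_orbit_toNNReal x).intervalIntegrable (μ := volume) a b
  filter_upwards [self_mem_nhdsWithin] with h hh
  have hh' : 0 < h := hh
  rw [← smul_sub, zero_add]
  congr 1
  have e : T h.toNNReal (∫ r in (0 : ℝ)..s, T r.toNNReal x) =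
      ∫ r in h..(s + h), T r.toNNReal x := by
    have e1 := ((T h.toNNReal).restrictScalars ℝ).intervalIntegral_comp_comm (hi 0 s)
    have e2 := intervalIntegral.integral_comp_add_right (a := 0) (b := s)
      (fun r => T r.toNNReal x) h
    rw [zero_add] at e2
    rw [← e2]
    refine e1.symm.trans (intervalIntegral.integral_congr fun r hr => ?_)
    rw [uIcc_of_le hs.le] at hr
    simp only [ContinuousLinearMap.coe_restrictScalars']
    rw [← hT.apply_add, Real.toNNReal_add hr.1 hh'.le, add_comm]
  rw [e, sub_eq_sub_iff_add_eq_add, add_comm,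
    intervalIntegral.integral_add_adjacent_intervals (hi _ _) (hi _ _),
    add_comm (∫ r in h..(s + h), T r.toNNReal x),
    intervalIntegral.integral_add_adjacent_intervals (hi _ _) (hi _ _)]

theorem IsC0Semigroup.dense_generator_domain (hT : IsC0Semigroup T) :
    Dense {x : X | ∃ y, HasGeneratorValue T x y} := by
  intro x
  have h := hT.tendsto_average x 0
  rw [Real.toNNReal_zero, hT.apply_zero] at h
  refine mem_closure_of_tendsto h ?_
  filter_upwards [self_mem_nhdsWithin] with s hs
  rw [zero_add]
  have := (hT.hasGeneratorValue_integral x hs).smul ((s⁻¹ : ℝ) : 𝕜)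
  rw [← RCLike.real_smul_eq_coe_smul] at this
  exact ⟨_, this⟩

/-- A strongly continuous semigroup is determined by its generator. -/
theorem IsC0Semigroup.eq_of_generator_eq (hT : IsC0Semigroup T) (hG : IsC0Semigroup G)
    (h : generator T = generator G) (t : ℝ≥0) : T t = G t := by
  have key : ∀ x y, HasGeneratorValue T x y → T t x = G t x := by
    intro x y hx
    obtain ⟨C, hC⟩ := hG.exists_bound t
    have hCr : ∀ s : ℝ, 0 ≤ s → ‖G ((t : ℝ) - s).toNNReal‖ ≤ C := fun s hs =>
      hC _ (Real.toNNReal_le_iff_le_coe.2 (by linarith))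
    have hGc : ∀ z : X, Continuous fun s : ℝ => G ((t : ℝ) - s).toNNReal z := fun z =>
      (hG.continuous_orbit_toNNReal z).comp (by fun_prop : Continuous fun s : ℝ => (t : ℝ) - s)
    have hcont : ContinuousOn (fun s : ℝ => G ((t : ℝ) - s).toNNReal (T s.toNNReal x))
        (Icc 0 (t : ℝ)) := fun s _ =>
      tendsto_apply_of_bounded (C := C)
        (by filter_upwards [self_mem_nhdsWithin] with r hr using hCr r hr.1)
        (hT.continuous_orbit_toNNReal x).continuousWithinAt
        (hGc (T s.toNNReal x)).continuousWithinAt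
    -- With z = T(s)x, the slope from s to r is G(t - r) applied to the difference of the quotients
    -- of T and G at z. Both quotients tend to the common generator value at z, and G is bounded on
    -- [0, t], so the slope tends to 0.
    have hder : ∀ s ∈ Ico 0 (t : ℝ), HasDerivWithinAt
        (fun s : ℝ => G ((t : ℝ) - s).toNNReal (T s.toNNReal x)) 0 (Ici s) s := by
      intro s hs
      rw [← hasDerivWithinAt_Ioi_iff_Ici, hasDerivWithinAt_iff_tendsto_slope' (by simp)]
      have hz := hx.apply hT s.toNNReal
      have h1 := hz.hasDerivWithinAt hT le_rfl
      have h2 := (hz.of_generator_eq h).hasDerivWithinAt hG le_rfl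
      rw [hasDerivWithinAt_iff_tendsto_slope' (by simp)] at h1 h2
      have h3 : Tendsto (fun r : ℝ => r - s) (𝓝[>] s) (𝓝[>] 0) := by
        refine tendsto_nhdsWithin_iff.2 ⟨?_, ?_⟩
        · have : Continuous fun r : ℝ => r - s := by fun_prop
          have := this.tendsto s
          rw [sub_self] at this
          exact this.mono_left nhdsWithin_le_nhds
        · filter_upwards [self_mem_nhdsWithin] with r hr
          exact sub_pos.2 (mem_Ioi.1 hr)
      have h4 := (h1.sub h2).comp h3
      rw [Real.toNNReal_zero, hT.apply_zero, hG.apply_zero, sub_self] at h4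
      have h5 := tendsto_apply_of_bounded (C := C)
        (A := fun r : ℝ => G ((t : ℝ) - r).toNNReal) (z := 0)
        (by filter_upwards [self_mem_nhdsWithin] with r hr using
          hCr r (hs.1.trans (mem_Ioi.1 hr).le)) h4 (by simp)
      refine h5.congr' ?_
      filter_upwards [Ioo_mem_nhdsGT hs.2] with r hr
      have e1 : T (r - s).toNNReal (T s.toNNReal x) = T r.toNNReal x := by
        rw [← hT.apply_add, ← Real.toNNReal_add (by linarith [hr.1]) hs.1, sub_add_cancel]
      have e2 : G ((t : ℝ) - r).toNNReal (G (r - s).toNNReal (T s.toNNReal x)) =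
          G ((t : ℝ) - s).toNNReal (T s.toNNReal x) := by
        rw [← hG.apply_add, ← Real.toNNReal_add (by linarith [hr.2]) (by linarith [hr.1]),
          sub_add_sub_cancel]
      simp only [Function.comp_apply, slope_def_module, sub_zero, Real.toNNReal_zero,
        hT.apply_zero, hG.apply_zero]
      rw [← smul_sub, sub_sub_sub_cancel_right, e1]
      rw [RCLike.real_smul_eq_coe_smul (K := 𝕜), _root_.map_smul, _root_.map_sub, e2,
        ← RCLike.real_smul_eq_coe_smul]
    have := constant_of_has_deriv_right_zero hcont hder t ⟨t.2, le_rfl⟩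
    simpa [hT.apply_zero, hG.apply_zero] using this
  refine ContinuousLinearMap.ext fun x => ?_
  have : (T t : X → X) = G t :=
    Continuous.ext_on hT.dense_generator_domain (T t).continuous (G t).continuous
      fun x ⟨y, hy⟩ => key x y hy
  exact congrFun this x

end Abstract

/-! ### Translations on `L^p(0,1)` -/

section Shift

variable {𝕜 : Type*} [RCLike 𝕜] {p : ℝ≥0∞}

/-- The extension of a function on `(0,1)` by zero. -/
def zeroExtFun (f : ℝ → 𝕜) : ℝ → 𝕜 := indicator (Ioo (0 : ℝ) 1) f

theorem zeroExtFun_of_mem {f : ℝ → 𝕜} {x : ℝ} (hx : x ∈ Ioo (0 : ℝ) 1) :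
    zeroExtFun f x = f x := indicator_of_mem hx f

theorem zeroExtFun_of_notMem {f : ℝ → 𝕜} {x : ℝ} (hx : x ∉ Ioo (0 : ℝ) 1) :
    zeroExtFun f x = 0 := indicator_of_notMem hx f

theorem memLp_zeroExtFun (f : Lp01 𝕜 p) : MemLp (zeroExtFun f) p (volume : Measure ℝ) :=
  (memLp_indicator_iff_restrict measurableSet_Ioo).2 (Lp.memLp f)

variable [Fact (1 ≤ p)]

theorem integrable_zeroExtFun (f : Lp01 𝕜 p) : Integrable (zeroExtFun f) (volume : Measure ℝ) :=
  (integrable_indicator_iff measurableSet_Ioo).2 (integrable_lp01 f)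

theorem zeroExtFun_congr {f g : ℝ → 𝕜} (h : f =ᵐ[unitMeasure] g) :
    zeroExtFun f =ᵐ[volume] zeroExtFun g :=
  (ae_restrict_iff' measurableSet_Ioo |>.1 h).mono fun x hx => by
    by_cases hm : x ∈ Ioo (0 : ℝ) 1
    · rw [zeroExtFun_of_mem hm, zeroExtFun_of_mem hm, hx hm]
    · rw [zeroExtFun_of_notMem hm, zeroExtFun_of_notMem hm]

variable (𝕜 p) in
/-- The extension by zero `L^p(0,1) → L^p(ℝ)`. -/
def zeroExt : Lp01 𝕜 p →L[𝕜] Lp 𝕜 p (volume : Measure ℝ) :=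
  LinearMap.mkContinuous
    { toFun := fun f => (memLp_zeroExtFun f).toLp _
      map_add' := fun f g => by
        rw [← MemLp.toLp_add]
        refine (MemLp.toLp_eq_toLp_iff _ _).2 ?_
        refine (zeroExtFun_congr (Lp.coeFn_add f g)).trans (Eventually.of_forall fun x => ?_)
        exact congrFun (indicator_add _ _ _) x
      map_smul' := fun c f => by
        rw [RingHom.id_apply, ← MemLp.toLp_const_smul]
        refine (MemLp.toLp_eq_toLp_iff _ _).2 ?_
        refine (zeroExtFun_congr (Lp.coeFn_smul c f)).trans (Eventually.of_forall fun x => ?_)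
        exact congrFun (indicator_const_smul (Ioo (0 : ℝ) 1) c f) x }
    1 fun f => by
      rw [one_mul, Lp.norm_def f]
      simp only [LinearMap.coe_mk, AddHom.coe_mk]
      rw [Lp.norm_toLp, zeroExtFun, eLpNorm_indicator_eq_eLpNorm_restrict measurableSet_Ioo]

theorem coeFn_zeroExt (f : Lp01 𝕜 p) : zeroExt 𝕜 p f =ᵐ[volume] zeroExtFun f :=
  MemLp.coeFn_toLp (memLp_zeroExtFun f)

variable (𝕜 p) in
/-- Translation by `s` on `L^p(0,1)`: functions are extended by zero, translated, and
restricted. -/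
def shift (s : ℝ) : Lp01 𝕜 p →L[𝕜] Lp01 𝕜 p :=
  (LpToLpRestrictCLM ℝ 𝕜 𝕜 volume p (Ioo (0 : ℝ) 1)).comp
    ((Lp.compMeasurePreservingₗᵢ 𝕜 (fun x : ℝ => x - s)
      (measurePreserving_sub_right volume s)).toContinuousLinearMap.comp (zeroExt 𝕜 p))

theorem coeFn_shift (s : ℝ) (f : Lp01 𝕜 p) :
    shift 𝕜 p s f =ᵐ[unitMeasure] fun x => zeroExtFun f (x - s) := by
  have h1 := LpToLpRestrictCLM_coeFn 𝕜 (Ioo (0 : ℝ) 1)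
    (Lp.compMeasurePreserving (fun x : ℝ => x - s) (measurePreserving_sub_right volume s)
      (zeroExt 𝕜 p f))
  have h2 := Lp.coeFn_compMeasurePreserving (zeroExt 𝕜 p f)
    (measurePreserving_sub_right (volume : Measure ℝ) s)
  have h3 := (measurePreserving_sub_right (volume : Measure ℝ) s).quasiMeasurePreserving.ae_eq_comp
    (coeFn_zeroExt f)
  exact h1.trans (ae_restrict_of_ae (h2.trans h3))

/-- Continuity of translations in L^p; this is the point where p < ∞ enters. -/
theorem continuous_shift (hp : p ≠ ⊤) (f : Lp01 𝕜 p) : Continuous fun s => shift 𝕜 p s f := by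
  refine (LpToLpRestrictCLM ℝ 𝕜 𝕜 volume p (Ioo (0 : ℝ) 1)).continuous.comp ?_
  exact continuous_const.compMeasurePreservingLp
    (g := fun s : ℝ => (⟨fun x => x - s, by fun_prop⟩ : C(ℝ, ℝ)))
    (ContinuousMap.continuous_of_continuous_uncurry _ (by
      show Continuous fun q : ℝ × ℝ => q.2 - q.1
      fun_prop))
    (fun s => measurePreserving_sub_right volume s) hp

theorem shift_eq_zero {s : ℝ} (hs : 1 ≤ |s|) (f : Lp01 𝕜 p) : shift 𝕜 p s f = 0 := by
  refine Lp.ext ((coeFn_shift s f).trans (EventuallyEq.trans ?_ (Lp.coeFn_zero _ _ _).symm))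
  filter_upwards [ae_restrict_mem measurableSet_Ioo] with x hx
  refine zeroExtFun_of_notMem fun h => ?_
  rcases le_abs.1 hs with h' | h' <;> linarith [hx.1, hx.2, h.1, h.2]

/-- Integration against a bounded weight is a bounded functional on `L^p(0,1)`. -/
def pairing (η : ℝ → ℝ) (hη : Measurable η) (C : ℝ) (hC : ∀ x, ‖η x‖ ≤ C) :
    Lp01 𝕜 p →L[ℝ] 𝕜 :=
  have hi : ∀ f : Lp01 𝕜 p, Integrable (fun x => η x • f x) unitMeasure := fun f =>
    (integrable_lp01 f).bdd_smul C hη.aestronglyMeasurable (ae_of_all _ hC)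
  LinearMap.mkContinuous
    { toFun := fun f => ∫ x in Ioo (0 : ℝ) 1, η x • f x
      map_add' := fun f g => by
        rw [← integral_add (hi f) (hi g)]
        refine integral_congr_ae ?_
        filter_upwards [Lp.coeFn_add f g] with x hx
        rw [hx, Pi.add_apply, smul_add]
      map_smul' := fun c f => by
        rw [RingHom.id_apply, ← integral_smul]
        refine integral_congr_ae ?_
        filter_upwards [Lp.coeFn_smul c f] with x hx
        rw [hx, Pi.smul_apply, smul_comm] }
    C fun f => by
      have hC0 : 0 ≤ C := (norm_nonneg _).trans (hC 0)
      have : IsProbabilityMeasure unitMeasure := ⟨by simp⟩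
      have h1 : ∫ x in Ioo (0 : ℝ) 1, ‖f x‖ ≤ ‖f‖ := by
        rw [integral_norm_eq_lintegral_enorm (integrable_lp01 f).1, ← eLpNorm_one_eq_lintegral_enorm,
          Lp.norm_def]
        exact ENNReal.toReal_mono (Lp.eLpNorm_ne_top f)
          (eLpNorm_le_eLpNorm_of_exponent_le Fact.out (Lp.aestronglyMeasurable f))
      calc ‖∫ x in Ioo (0 : ℝ) 1, η x • f x‖ ≤ ∫ x in Ioo (0 : ℝ) 1, C * ‖f x‖ := by
            refine norm_integral_le_of_norm_le ((integrable_lp01 f).norm.const_mul C)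
              (ae_of_all _ fun x => ?_)
            rw [norm_smul]
            exact mul_le_mul_of_nonneg_right (hC x) (norm_nonneg _)
        _ = C * ∫ x in Ioo (0 : ℝ) 1, ‖f x‖ := integral_const_mul _ _
        _ ≤ C * ‖f‖ := mul_le_mul_of_nonneg_left h1 hC0

theorem pairing_apply (η : ℝ → ℝ) (hη : Measurable η) (C : ℝ) (hC : ∀ x, ‖η x‖ ≤ C)
    (f : Lp01 𝕜 p) : pairing η hη C hC f = ∫ x in Ioo (0 : ℝ) 1, η x • f x := rfl

/-- A Bochner integral in L^p has no pointwise meaning a priori, so both sides are tested against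
indicators of measurable sets: the pairing commutes with the integral, and Fubini does the rest. -/
theorem coeFn_integral_shift (hp : p ≠ ⊤) {a b : ℝ} (hab : a ≤ b) (f : Lp01 𝕜 p) :
    (∫ r in a..b, shift 𝕜 p r f : Lp01 𝕜 p) =ᵐ[unitMeasure]
      fun x => ∫ r in (x - b)..(x - a), zeroExtFun f r := by
  have e0 : ∀ x, ∫ r in (x - b)..(x - a), zeroExtFun f r =
      ∫ r in Ioc a b, zeroExtFun f (x - r) := fun x => by
    rw [← intervalIntegral.integral_comp_sub_left, intervalIntegral.integral_of_le hab]
  simp only [e0]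
  -- The integrand is that of the convolution of f with the constant 1 for the finite measure on (a,
  -- b], hence jointly integrable.
  have hint : Integrable (fun q : ℝ × ℝ => zeroExtFun f (q.1 - q.2))
      (unitMeasure.prod (volume.restrict (Ioc a b))) := by
    have h := Integrable.convolution_integrand (ContinuousLinearMap.lsmul ℝ ℝ)
      (μ := (volume : Measure ℝ)) (ν := volume.restrict (Ioc a b))
      (integrable_const (1 : ℝ)) (integrable_zeroExtFun f)
    simp only [ContinuousLinearMap.lsmul_apply, one_smul] at h
    refine h.mono_measure ?_
    exact Measure.prod_mono Measure.restrict_le_self le_rfl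
  refine Integrable.ae_eq_of_forall_setIntegral_eq _ _ (integrable_lp01 _)
    hint.integral_prod_left fun E hE _ => ?_
  set η : ℝ → ℝ := indicator E 1 with hη
  have hηm : Measurable η := measurable_one.indicator hE
  have hηC : ∀ x, ‖η x‖ ≤ 1 := fun x => by
    by_cases hx : x ∈ E <;> simp [hη, hx]
  have hEη : ∀ u : ℝ → 𝕜, ∫ x in E, u x ∂unitMeasure = ∫ x in Ioo (0 : ℝ) 1, η x • u x := by
    intro u
    rw [← integral_indicator hE]
    refine integral_congr_ae (ae_of_all _ fun x => ?_)
    by_cases hx : x ∈ E <;> simp [hη, hx]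
  rw [hEη, hEη, ← pairing_apply η hηm 1 hηC]
  rw [← ContinuousLinearMap.intervalIntegral_comp_comm _
    ((continuous_shift hp f).intervalIntegrable _ _), intervalIntegral.integral_of_le hab]
  simp only [← integral_smul]
  rw [integral_integral_swap (f := fun x r => η x • zeroExtFun f (x - r))
    (hint.bdd_smul 1 (hηm.comp measurable_fst).aestronglyMeasurable
      (ae_of_all _ fun q => hηC q.1))]
  refine integral_congr_ae (ae_of_all _ fun r => integral_congr_ae ?_)
  filter_upwards [coeFn_shift r f] with x hx
  simp only [hx]

end Shift

/-! ### The flow of the system with all components transported to the right -/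

section Flow

variable {𝕜 : Type*} [RCLike 𝕜] {p : ℝ≥0∞} {J : Type*}

/-- The fractional part is piecewise one of countably many translations, so it pulls null sets back
to null sets. Positivity discards the countable set s + ℤ. -/
theorem ae_fract_sub {P : ℝ → Prop} (h : ∀ᵐ y ∂unitMeasure, P y) (s : ℝ) :
    ∀ᵐ x ∂(volume : Measure ℝ), 0 < Int.fract (x - s) ∧ P (Int.fract (x - s)) := by
  have h0 := (ae_restrict_iff' measurableSet_Ioo).1 h
  have h1 : ∀ᵐ x ∂(volume : Measure ℝ), ∀ n : ℤ, x - (s + n) ∈ Ioo (0 : ℝ) 1 → P (x - (s + n)) :=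
    ae_all_iff.2 fun n =>
      (measurePreserving_sub_right (volume : Measure ℝ) (s + n)).quasiMeasurePreserving.ae h0
  have h2 : ∀ᵐ x ∂(volume : Measure ℝ), ∀ n : ℤ, x ≠ s + n :=
    ae_all_iff.2 fun n => Measure.ae_ne volume _
  filter_upwards [h1, h2] with x hx1 hx2
  have e : Int.fract (x - s) = x - (s + ⌊x - s⌋) := by rw [Int.fract]; ring
  have hpos : 0 < Int.fract (x - s) := by
    refine lt_of_le_of_ne (Int.fract_nonneg _) fun h => hx2 ⌊x - s⌋ ?_
    rw [e] at h
    linarith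
  refine ⟨hpos, ?_⟩
  have h3 := hx1 ⌊x - s⌋
  rw [← e] at h3
  exact h3 ⟨hpos, Int.fract_lt_one _⟩

theorem ae_unitMeasure_fract_sub {P : ℝ → Prop} (h : ∀ᵐ y ∂unitMeasure, P y) (s : ℝ) :
    ∀ᵐ x ∂unitMeasure, 0 < Int.fract (x - s) ∧ P (Int.fract (x - s)) :=
  ae_restrict_of_ae (ae_fract_sub h s)

/-- Of all shifts by t - n, exactly one sees the point x; this collapses the sum defining `flow` to
a single power of B. -/
theorem zeroExtFun_sub_sub (f : ℝ → 𝕜) {x t : ℝ} (h : 0 < Int.fract (x - t)) (n : ℕ) :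
    zeroExtFun f (x - (t - n)) = if (n : ℤ) = -⌊x - t⌋ then f (Int.fract (x - t)) else 0 := by
  split_ifs with hn
  · have e : x - (t - n) = Int.fract (x - t) := by
      have : (n : ℝ) = -(⌊x - t⌋ : ℝ) := by exact_mod_cast hn
      rw [Int.fract, this]
      ring
    rw [e, zeroExtFun_of_mem ⟨h, Int.fract_lt_one _⟩]
  · refine zeroExtFun_of_notMem fun hm => hn ?_
    have : ⌊x - t⌋ = -(n : ℤ) := by
      rw [Int.floor_eq_iff]
      push_cast
      constructor <;> linarith [hm.1, hm.2]
    omega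

variable [Fact (1 ≤ p)]

variable (𝕜 p J) in
/-- Translation of all components of a vector of `L^p` functions. -/
def shiftPi (s : ℝ) : (J → Lp01 𝕜 p) →L[𝕜] (J → Lp01 𝕜 p) :=
  ContinuousLinearMap.pi fun j => (shift 𝕜 p s).comp (ContinuousLinearMap.proj j)

theorem shiftPi_apply (s : ℝ) (w : J → Lp01 𝕜 p) (j : J) :
    shiftPi 𝕜 p J s w j = shift 𝕜 p s (w j) := rfl

theorem continuous_shiftPi (hp : p ≠ ⊤) (w : J → Lp01 𝕜 p) :
    Continuous fun s => shiftPi 𝕜 p J s w :=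
  continuous_pi fun j => continuous_shift hp (w j)

theorem shiftPi_eq_zero {s : ℝ} (hs : 1 ≤ |s|) (w : J → Lp01 𝕜 p) : shiftPi 𝕜 p J s w = 0 :=
  funext fun j => shift_eq_zero hs (w j)

variable [Fintype J]

variable (p) in
/-- A scalar matrix acting on vectors of `L^p` functions. -/
def matAct (M : Matrix J J 𝕜) : (J → Lp01 𝕜 p) →L[𝕜] (J → Lp01 𝕜 p) :=
  ContinuousLinearMap.pi fun j => ∑ k, M j k • ContinuousLinearMap.proj k

theorem matAct_apply (M : Matrix J J 𝕜) (w : J → Lp01 𝕜 p) (j : J) :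
    matAct p M w j = ∑ k, M j k • w k := by
  simp [matAct]

theorem coeFn_matAct_shiftPi (M : Matrix J J 𝕜) (s : ℝ) (w : J → Lp01 𝕜 p) (j : J) :
    matAct p M (shiftPi 𝕜 p J s w) j =ᵐ[unitMeasure]
      fun x => (M *ᵥ fun k => zeroExtFun (w k) (x - s)) j := by
  rw [matAct_apply]
  have h1 : ∀ᵐ x ∂unitMeasure, ∀ k, shift 𝕜 p s (w k) x = zeroExtFun (w k) (x - s) :=
    ae_all_iff.2 fun k => coeFn_shift s (w k)
  have h2 : ∀ᵐ x ∂unitMeasure, ∀ k, (M j k • shift 𝕜 p s (w k) : Lp01 𝕜 p) x =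
      M j k * shift 𝕜 p s (w k) x :=
    ae_all_iff.2 fun k => Lp.coeFn_smul _ _
  have h3 := Lp.coeFn_fun_finsetSum Finset.univ fun k => M j k • shift 𝕜 p s (w k)
  filter_upwards [h1, h2, h3] with x h1 h2 h3
  simp only [shiftPi_apply]
  rw [h3, Matrix.mulVec, dotProduct]
  exact Finset.sum_congr rfl fun k _ => by rw [h2 k, h1 k]

variable [DecidableEq J]

/-- The extension to the left of a function on `(0,1)` by the rule `w(y) = B w(y + 1)`. -/
def leftExt (B : Matrix J J 𝕜) (w : J → ℝ → 𝕜) (y : ℝ) : J → 𝕜 :=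
  B ^ (-⌊y⌋).toNat *ᵥ fun k => w k (Int.fract y)

theorem leftExt_of_mem (B : Matrix J J 𝕜) (w : J → ℝ → 𝕜) {y : ℝ} {n : ℕ}
    (h0 : 0 < y + n) (h1 : y + n < 1) :
    leftExt B w y = B ^ n *ᵥ fun k => w k (y + n) := by
  have e : ⌊y⌋ = -(n : ℤ) := by
    rw [Int.floor_eq_iff]
    push_cast
    constructor <;> linarith
  have e2 : Int.fract y = y + n := by
    rw [Int.fract, e]
    push_cast
    ring
  rw [leftExt, e, e2, neg_neg, Int.toNat_natCast]

variable (p) in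
/-- The flow of `w' = -∂ₓ w` on `(0,1)` with boundary condition `w(0) = B w(1)`. -/
def flow (B : Matrix J J 𝕜) (t : ℝ≥0) : (J → Lp01 𝕜 p) →L[𝕜] (J → Lp01 𝕜 p) :=
  -- A shift by t - n vanishes as soon as n ≥ t + 1, so no nonzero term is left out.
  ∑ n ∈ Finset.range (⌈t⌉₊ + 2), (matAct p (B ^ n)).comp (shiftPi 𝕜 p J ((t : ℝ) - n))

/-- Surplus terms vanish, so nearby times may share one number of summands; strong continuity relies
on this. -/
theorem flow_apply_eq_sum (B : Matrix J J 𝕜) {t : ℝ≥0} {N : ℕ} (hN : ⌈t⌉₊ + 2 ≤ N)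
    (w : J → Lp01 𝕜 p) :
    flow p B t w = ∑ n ∈ Finset.range N, matAct p (B ^ n) (shiftPi 𝕜 p J ((t : ℝ) - n) w) := by
  rw [flow, _root_.sum_apply]
  refine Finset.sum_subset (Finset.range_subset_range.2 hN) fun n _ hn => ?_
  have h1 : ⌈t⌉₊ + 2 ≤ n := by simpa using hn
  have h2 : (t : ℝ) ≤ ⌈t⌉₊ := by exact_mod_cast Nat.le_ceil t
  have h3 : ((⌈t⌉₊ : ℝ) + 2) ≤ n := by exact_mod_cast h1
  rw [ContinuousLinearMap.comp_apply, shiftPi_eq_zero, _root_.map_zero]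
  rw [abs_of_nonpos] <;> linarith

theorem coeFn_flow (B : Matrix J J 𝕜) (t : ℝ≥0) (w : J → Lp01 𝕜 p) :
    ∀ᵐ x ∂unitMeasure, ∀ j, flow p B t w j x = leftExt B (fun k => w k) (x - t) j := by
  refine ae_all_iff.2 fun j => ?_
  rw [flow_apply_eq_sum B le_rfl, Finset.sum_apply]
  have h1 : ∀ᵐ x ∂unitMeasure, ∀ n : ℕ, matAct p (B ^ n) (shiftPi 𝕜 p J ((t : ℝ) - n) w) j x =
      (B ^ n *ᵥ fun k => zeroExtFun (w k) (x - (t - n))) j :=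
    ae_all_iff.2 fun n => coeFn_matAct_shiftPi _ _ _ _
  have h2 := Lp.coeFn_fun_finsetSum (Finset.range (⌈t⌉₊ + 2)) fun n =>
    matAct p (B ^ n) (shiftPi 𝕜 p J ((t : ℝ) - n) w) j
  have h3 := ae_unitMeasure_fract_sub (P := fun _ => True) (by simp) t
  filter_upwards [h1, h2, h3, ae_restrict_mem measurableSet_Ioo] with x h1 h2 h3 hx
  -- `leftExt` truncates the exponent by `toNat`; since x - t < 1 nothing is truncated.
  have hfl : ⌊x - t⌋ ≤ 0 := by
    have : ⌊x - t⌋ < 1 := Int.floor_lt.2 (by push_cast; linarith [hx.2, t.2])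
    omega
  have hce : -⌊x - t⌋ ≤ (⌈t⌉₊ : ℤ) := by
    have h4 : (t : ℝ) ≤ ⌈t⌉₊ := by exact_mod_cast Nat.le_ceil t
    have : -(⌈t⌉₊ : ℤ) ≤ ⌊x - t⌋ := Int.le_floor.2 (by push_cast; linarith [hx.1])
    omega
  rw [h2, Finset.sum_eq_single (-⌊x - t⌋).toNat]
  · rw [h1]
    simp only [zeroExtFun_sub_sub _ h3.1]
    rw [Int.toNat_of_nonneg (by omega)]
    simp [leftExt]
  · intro n _ hn
    have hn' : ¬(n : ℤ) = -⌊x - t⌋ := by omega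
    rw [h1]
    simp only [zeroExtFun_sub_sub _ h3.1, if_neg hn']
    exact congrFun (Matrix.mulVec_zero _) j
  · intro h
    exact absurd (Finset.mem_range.2 (by omega)) h

theorem isC0Semigroup_flow (hp : p ≠ ⊤) (B : Matrix J J 𝕜) : IsC0Semigroup (flow p B) where
  map_zero := by
    refine ContinuousLinearMap.ext fun w => funext fun j => Lp.ext ?_
    filter_upwards [coeFn_flow B 0 w, ae_restrict_mem measurableSet_Ioo] with x h hx
    rw [h j, NNReal.coe_zero, sub_zero, leftExt_of_mem (n := 0) B _ (by simpa using hx.1)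
      (by simpa using hx.2)]
    simp
  map_add s t := by
    refine ContinuousLinearMap.ext fun w => funext fun j => Lp.ext ?_
    filter_upwards [coeFn_flow B (s + t) w, coeFn_flow B s (flow p B t w),
      ae_unitMeasure_fract_sub (coeFn_flow B t w) s, ae_restrict_mem measurableSet_Ioo]
      with x h1 h2 h3 hx
    have e : (fun k => flow p B t w k (Int.fract (x - s))) =
        leftExt B (fun k => w k) (Int.fract (x - s) - t) := funext h3.2
    -- Going back by s and then by t lands an integer away from x - (s + t). The floors therefore
    -- add up, and with them the powers of B; `l1` and `l2` ensure that `toNat` respects this.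
    have e1 : Int.fract (x - s) - t = x - (s + t : ℝ≥0) - (⌊x - s⌋ : ℤ) := by
      rw [Int.fract, NNReal.coe_add]
      ring
    have l1 : ⌊x - s⌋ ≤ 0 := by
      have : ⌊x - s⌋ < 1 := Int.floor_lt.2 (by push_cast; linarith [hx.2, s.2])
      omega
    have l2 : ⌊Int.fract (x - s) - t⌋ ≤ 0 := by
      have : ⌊Int.fract (x - s) - t⌋ < 1 := Int.floor_lt.2 (by
        push_cast; linarith [Int.fract_lt_one (x - s), t.2])
      omega
    rw [e1, Int.floor_sub_intCast] at l2
    rw [h1 j, ContinuousLinearMap.comp_apply, h2 j]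
    refine congrFun ?_ j
    rw [leftExt, leftExt, e, leftExt, e1, Matrix.mulVec_mulVec, ← pow_add, Int.floor_sub_intCast,
      Int.fract_sub_intCast]
    congr 2
    omega
  continuous_orbit w := by
    refine continuous_iff_continuousAt.2 fun t₀ => ?_
    have h : Continuous fun t : ℝ≥0 => ∑ n ∈ Finset.range (⌈t₀ + 1⌉₊ + 2),
        matAct p (B ^ n) (shiftPi 𝕜 p J ((t : ℝ) - n) w) :=
      continuous_finsetSum _ fun n _ => (matAct p (B ^ n)).continuous.comp
        ((continuous_shiftPi hp w).comp (by fun_prop))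
    refine h.continuousAt.congr ?_
    filter_upwards [Iio_mem_nhds (lt_add_one t₀)] with t ht
    rw [flow_apply_eq_sum]
    gcongr
    exact le_of_lt ht

/-- Up to time 1 data cross the boundary at most once. The computation of the generator uses only
this two-term form. -/
theorem flow_apply_of_le_one (B : Matrix J J 𝕜) {t : ℝ≥0} (ht : t ≤ 1) (w : J → Lp01 𝕜 p) :
    flow p B t w = shiftPi 𝕜 p J t w + matAct p B (shiftPi 𝕜 p J ((t : ℝ) - 1) w) := by
  have h1 : ⌈t⌉₊ + 2 ≤ 3 := by
    have : ⌈t⌉₊ ≤ 1 := Nat.ceil_le.2 (by simpa using ht)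
    omega
  have h2 : (t : ℝ) ≤ 1 := by exact_mod_cast ht
  rw [flow_apply_eq_sum B h1, Finset.sum_range_succ, Finset.sum_range_succ, Finset.sum_range_one,
    shiftPi_eq_zero (s := (t : ℝ) - (2 : ℕ))]
  · have e : ∀ v : J → Lp01 𝕜 p, matAct p (1 : Matrix J J 𝕜) v = v := fun v => funext fun j => by
      rw [matAct_apply]
      simp [Matrix.one_apply, ite_smul]
    simp [e]
  · push_cast
    rw [abs_of_nonpos] <;> linarith

end Flow

/-! ### Weak derivatives and primitives -/

section WeakDeriv

variable {𝕜 : Type*} [RCLike 𝕜]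

theorem exists_Icc_of_tsupport_subset {φ : ℝ → ℝ} (hc : HasCompactSupport φ)
    (hs : tsupport φ ⊆ Ioo (0 : ℝ) 1) :
    ∃ a b : ℝ, 0 < a ∧ b < 1 ∧ tsupport φ ⊆ Icc a b := by
  rcases (tsupport φ).eq_empty_or_nonempty with h | h
  · exact ⟨1, 0, one_pos, one_pos, by simp [h]⟩
  · obtain ⟨a, ha⟩ := hc.isCompact.exists_isLeast h
    obtain ⟨b, hb⟩ := hc.isCompact.exists_isGreatest h
    exact ⟨a, b, (hs ha.1).1, (hs hb.1).2, fun x hx => ⟨ha.2 hx, hb.2 hx⟩⟩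

/-- The primitive from 0 vanishes to the left of the support of ψ, and the zero mean makes it vanish
to the right as well. -/
theorem exists_testFunction_deriv_eq {ψ : ℝ → ℝ} (h1 : ContDiff ℝ ∞ ψ) (h2 : HasCompactSupport ψ)
    (h3 : tsupport ψ ⊆ Ioo (0 : ℝ) 1) (h0 : ∫ x in Ioo (0 : ℝ) 1, ψ x = 0) :
    ∃ φ : ℝ → ℝ, ContDiff ℝ ∞ φ ∧ HasCompactSupport φ ∧ tsupport φ ⊆ Ioo (0 : ℝ) 1 ∧
      deriv φ = ψ := by
  obtain ⟨a, b, ha, hb, hab⟩ := exists_Icc_of_tsupport_subset h2 h3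
  have hz : ∀ x, x ∉ Icc a b → ψ x = 0 := fun x hx =>
    image_eq_zero_of_notMem_tsupport fun h => hx (hab h)
  have hd : ∀ x, HasDerivAt (fun y => ∫ t in (0 : ℝ)..y, ψ t) (ψ x) x := fun x =>
    h1.continuous.integral_hasStrictDerivAt 0 x |>.hasDerivAt
  have hder : deriv (fun y => ∫ t in (0 : ℝ)..y, ψ t) = ψ := funext fun x => (hd x).deriv
  have hsupp : tsupport (fun y => ∫ t in (0 : ℝ)..y, ψ t) ⊆ Icc a b := by
    refine closure_minimal (fun x hx => ?_) isClosed_Icc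
    by_contra hx'
    refine hx ?_
    rcases not_and_or.1 hx' with h | h
    · refine intervalIntegral.integral_zero_ae (ae_of_all _ fun t ht => hz t fun ht' => ?_)
      rcases mem_uIoc.1 ht with ht | ht <;> linarith [ht.1, ht.2, ht'.1]
    · have e1 : ∫ t in (0 : ℝ)..1, ψ t = 0 := by
        rw [intervalIntegral.integral_of_le zero_le_one, integral_Ioc_eq_integral_Ioo, h0]
      have e2 : ∫ t in (1 : ℝ)..x, ψ t = 0 := by
        refine intervalIntegral.integral_zero_ae (ae_of_all _ fun t ht => hz t fun ht' => ?_)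
        rcases mem_uIoc.1 ht with ht | ht <;> linarith [ht.1, ht.2, ht'.2]
      simp only
      rw [← intervalIntegral.integral_add_adjacent_intervals (b := 1)
        (h1.continuous.intervalIntegrable _ _) (h1.continuous.intervalIntegrable _ _), e1, e2,
        add_zero]
  refine ⟨_, contDiff_infty_iff_deriv.2 ⟨fun x => (hd x).differentiableAt, by rwa [hder]⟩,
    isCompact_Icc.of_isClosed_subset (isClosed_tsupport _) hsupp,
    hsupp.trans (Icc_subset_Ioo ha hb), hder⟩

theorem integrable_testFunction_smul {φ : ℝ → ℝ} (hφ : Continuous φ) (hc : HasCompactSupport φ)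
    {u : ℝ → 𝕜} (hu : Integrable u unitMeasure) :
    Integrable (fun x => φ x • u x) unitMeasure := by
  obtain ⟨C, hC⟩ := hc.exists_bound_of_continuous hφ
  exact hu.bdd_smul C hφ.aestronglyMeasurable (ae_of_all _ hC)

/-- The lemma of du Bois-Reymond. -/
theorem ae_eq_const_of_integral_deriv_smul_eq_zero {u : ℝ → 𝕜} (hu : Integrable u unitMeasure)
    (h : ∀ φ : ℝ → ℝ, ContDiff ℝ ∞ φ → HasCompactSupport φ → tsupport φ ⊆ Ioo (0 : ℝ) 1 →
      ∫ x in Ioo (0 : ℝ) 1, deriv φ x • u x = 0) :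
    ∃ c : 𝕜, u =ᵐ[unitMeasure] fun _ => c := by
  let β : ContDiffBump (1 / 2 : ℝ) := ⟨1 / 8, 1 / 4, by norm_num, by norm_num⟩
  set ρ : ℝ → ℝ := β.normed volume with hρ
  have hρ1 : ContDiff ℝ ∞ ρ := β.contDiff_normed
  have hρ2 : HasCompactSupport ρ := β.hasCompactSupport_normed
  have hρ3 : tsupport ρ ⊆ Ioo (0 : ℝ) 1 := by
    rw [hρ, β.tsupport_normed_eq, Real.closedBall_eq_Icc]
    exact Icc_subset_Ioo (by norm_num [β]) (by norm_num [β])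
  have hI : ∀ η : ℝ → ℝ, tsupport η ⊆ Ioo (0 : ℝ) 1 → ∫ x in Ioo (0 : ℝ) 1, η x = ∫ x, η x :=
    fun η hη => setIntegral_eq_integral_of_forall_compl_eq_zero fun x hx =>
      image_eq_zero_of_notMem_tsupport fun h => hx (hη h)
  have hρ4 : ∫ x in Ioo (0 : ℝ) 1, ρ x = 1 := by rw [hI ρ hρ3, β.integral_normed]
  set c := ∫ x in Ioo (0 : ℝ) 1, ρ x • u x
  refine ⟨c, ?_⟩
  have hint : IntegrableOn (fun x => u x - c) (Ioo (0 : ℝ) 1) volume := hu.sub (integrable_const c)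
  have := isOpen_Ioo.ae_eq_zero_of_integral_contDiff_smul_eq_zero (μ := volume)
    (U := Ioo (0 : ℝ) 1) (f := fun x => u x - c) hint.locallyIntegrableOn ?_
  · refine (ae_restrict_iff' measurableSet_Ioo).2 ?_
    filter_upwards [this] with x hx hxU
    exact sub_eq_zero.1 (hx hxU)
  · intro η h1 h2 h3
    rw [← setIntegral_eq_integral_of_forall_compl_eq_zero (s := Ioo (0 : ℝ) 1) (fun x hx => by
      rw [image_eq_zero_of_notMem_tsupport fun h => hx (h3 h), zero_smul])]
    set m := ∫ x in Ioo (0 : ℝ) 1, η x with hm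
    have hηi : Integrable η unitMeasure := (h1.continuous.integrable_of_hasCompactSupport h2).restrict
    have hρi : Integrable ρ unitMeasure :=
      (hρ1.continuous.integrable_of_hasCompactSupport hρ2).restrict
    have hmρ2 : HasCompactSupport fun x => m * ρ x := hρ2.mul_left
    -- Subtracting m ρ, where ρ has mass 1, makes the mean zero, so the hypothesis on u applies. It
    -- yields ∫ η u = m ∫ ρ u = m c.
    obtain ⟨φ, hφ1, hφ2, hφ3, hφ⟩ := exists_testFunction_deriv_eq (ψ := fun x => η x - m * ρ x)
      (h1.sub (contDiff_const.mul hρ1)) (h2.sub hmρ2)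
      ((tsupport_sub η _).trans (union_subset h3
        ((closure_mono (Function.support_mul_subset_right _ _)).trans hρ3)))
      (by rw [integral_sub hηi (hρi.const_mul m), integral_const_mul, hρ4, mul_one, sub_self])
    have e := h φ hφ1 hφ2 hφ3
    rw [hφ] at e
    simp only [sub_smul, mul_smul] at e
    have hρu : Integrable (fun x => m • ρ x • u x) unitMeasure :=
      (integrable_testFunction_smul hρ1.continuous hρ2 hu).smul m
    rw [integral_sub (integrable_testFunction_smul h1.continuous h2 hu) hρu, integral_smul,
      sub_eq_zero] at e
    simp only [smul_sub]
    rw [integral_sub (integrable_testFunction_smul h1.continuous h2 hu) (hηi.smul_const c), e,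
      integral_smul_const, sub_self]

/-- Integration by parts of a test function against a primitive. -/
theorem integral_deriv_smul_primitive {g : ℝ → 𝕜} (hg : Integrable g) {φ : ℝ → ℝ}
    (h1 : ContDiff ℝ ∞ φ) (h2 : HasCompactSupport φ) (h3 : tsupport φ ⊆ Ioo (0 : ℝ) 1) :
    ∫ x in Ioo (0 : ℝ) 1, deriv φ x • ∫ t in (0 : ℝ)..x, g t =
      -∫ x in Ioo (0 : ℝ) 1, φ x • g x := by
  have hφ1 : φ 1 = 0 := image_eq_zero_of_notMem_tsupport fun h => lt_irrefl _ (h3 h).2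
  have hdc : Continuous (deriv φ) := h1.continuous_deriv (by simp)
  -- Fubini on the triangle t ≤ x: only the smooth factor φ is ever differentiated, never the
  -- primitive of g.
  have e1 : ∀ x ∈ Ioo (0 : ℝ) 1, deriv φ x • ∫ t in (0 : ℝ)..x, g t =
      ∫ t in Ioo (0 : ℝ) 1, indicator {q : ℝ × ℝ | q.2 ≤ q.1}
        (fun q => deriv φ q.1 • g q.2) (x, t) := by
    intro x hx
    have e : ∀ t, indicator {q : ℝ × ℝ | q.2 ≤ q.1} (fun q => deriv φ q.1 • g q.2) (x, t) =
        indicator (Iic x) (fun t => deriv φ x • g t) t := fun t => rfl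
    simp only [e]
    rw [setIntegral_indicator measurableSet_Iic, intervalIntegral.integral_of_le hx.1.le,
      ← integral_smul]
    congr 2
    ext t
    simp only [mem_inter_iff, mem_Ioc, mem_Ioo, mem_Iic]
    constructor
    · exact fun h => ⟨⟨h.1, h.2.trans_lt hx.2⟩, h.2⟩
    · exact fun h => ⟨h.1.1, h.2⟩
  have e2 : ∀ t ∈ Ioo (0 : ℝ) 1, ∫ x in Ioo (0 : ℝ) 1, indicator {q : ℝ × ℝ | q.2 ≤ q.1}
        (fun q => deriv φ q.1 • g q.2) (x, t) = -(φ t • g t) := by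
    intro t ht
    have e : ∀ x, indicator {q : ℝ × ℝ | q.2 ≤ q.1} (fun q => deriv φ q.1 • g q.2) (x, t) =
        indicator (Ici t) (fun x => deriv φ x • g t) x := fun x => rfl
    simp only [e]
    rw [setIntegral_indicator measurableSet_Ici, integral_smul_const]
    have : Ioo (0 : ℝ) 1 ∩ Ici t = Ico t 1 := by
      ext x
      simp only [mem_inter_iff, mem_Ico, mem_Ioo, mem_Ici]
      constructor
      · exact fun h => ⟨h.2, h.1.2⟩
      · exact fun h => ⟨⟨ht.1.trans_le h.1, h.2⟩, h.1⟩
    rw [this, integral_Ico_eq_integral_Ioc, ← intervalIntegral.integral_of_le ht.2.le,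
      intervalIntegral.integral_deriv_eq_sub
        (fun x _ => (h1.differentiable (by simp)).differentiableAt)
        (hdc.intervalIntegrable _ _), hφ1, zero_sub, neg_smul]
  rw [setIntegral_congr_fun measurableSet_Ioo e1, integral_integral_swap,
    setIntegral_congr_fun measurableSet_Ioo e2, integral_neg]
  have hi : Integrable (fun q : ℝ × ℝ => deriv φ q.1 • g q.2) (unitMeasure.prod unitMeasure) :=
    Integrable.smul_prod ((hdc.integrable_of_hasCompactSupport h2.deriv).restrict) hg.restrict
  exact hi.indicator (measurableSet_le measurable_snd measurable_fst)

variable {p : ℝ≥0∞} [Fact (1 ≤ p)]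

theorem HasWeakDeriv.exists_primitive {f g : Lp01 𝕜 p} (h : HasWeakDeriv f g) :
    ∃ c : 𝕜, f =ᵐ[unitMeasure] fun x => c + ∫ t in (0 : ℝ)..x, zeroExtFun g t := by
  have hg := integrable_zeroExtFun g
  have hG : Continuous fun x => ∫ t in (0 : ℝ)..x, zeroExtFun g t :=
    intervalIntegral.continuous_primitive (fun a b => hg.intervalIntegrable) 0
  have hGi : Integrable (fun x => ∫ t in (0 : ℝ)..x, zeroExtFun g t) unitMeasure :=
    (hG.integrableOn_Icc (a := 0) (b := 1)).mono_set Ioo_subset_Icc_self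
  obtain ⟨c, hc⟩ := ae_eq_const_of_integral_deriv_smul_eq_zero
    (u := fun x => f x - ∫ t in (0 : ℝ)..x, zeroExtFun g t) ((integrable_lp01 f).sub hGi)
    (fun φ h1 h2 h3 => by
      have hdc : Continuous (deriv φ) := h1.continuous_deriv (by simp)
      simp only [smul_sub]
      rw [integral_sub (integrable_smul_lp01 hdc h2.deriv f)
        (integrable_testFunction_smul hdc h2.deriv hGi), h φ h1 h2 h3,
        integral_deriv_smul_primitive hg h1 h2 h3, sub_eq_zero, neg_inj]
      refine setIntegral_congr_fun measurableSet_Ioo fun x hx => ?_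
      simp only [zeroExtFun_of_mem hx])
  refine ⟨c, ?_⟩
  filter_upwards [hc] with x hx
  rw [← hx, sub_add_cancel]

theorem HasWeakDeriv.exists_isContRep {f g : Lp01 𝕜 p} (h : HasWeakDeriv f g) :
    ∃ F : ℝ → 𝕜, IsContRep F f := by
  obtain ⟨c, hc⟩ := h.exists_primitive
  refine ⟨_, Continuous.continuousOn ?_, hc⟩
  exact continuous_const.add (intervalIntegral.continuous_primitive
    (fun a b => (integrable_zeroExtFun g).intervalIntegrable) 0)

/-- Continuous functions that agree almost everywhere on [0,1] agree at every point, so boundary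
values may be read off any continuous representative. -/
theorem HasWeakDeriv.eq_add_integral {f g : Lp01 𝕜 p} (h : HasWeakDeriv f g) {F : ℝ → 𝕜}
    (hF : IsContRep F f) {x : ℝ} (hx : x ∈ Icc (0 : ℝ) 1) :
    F x = F 0 + ∫ t in (0 : ℝ)..x, zeroExtFun g t := by
  obtain ⟨c, hc⟩ := h.exists_primitive
  have e : EqOn F (fun x => c + ∫ t in (0 : ℝ)..x, zeroExtFun g t) (Icc 0 1) := by
    refine Measure.eqOn_Icc_of_ae_eq volume zero_ne_one ?_ hF.1 (Continuous.continuousOn ?_)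
    · rw [← Measure.restrict_congr_set Ioo_ae_eq_Icc]
      exact hF.2.symm.trans hc
    · exact continuous_const.add (intervalIntegral.continuous_primitive
        (fun a b => (integrable_zeroExtFun g).intervalIntegrable) 0)
  rw [e hx, e ⟨le_rfl, zero_le_one⟩]
  simp

end WeakDeriv

/-! ### The generator of the flow -/

section FlowGenerator

variable {𝕜 : Type*} [RCLike 𝕜] {p : ℝ≥0∞} {J : Type*} [Fintype J]

/-- The primitive, vanishing at `0`, of the extension by zero of a function on `(0,1)`. -/
def primitive (y : ℝ → 𝕜) (x : ℝ) : 𝕜 := ∫ t in (0 : ℝ)..x, zeroExtFun y t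

theorem primitive_of_nonpos (y : ℝ → 𝕜) {x : ℝ} (hx : x ≤ 0) : primitive y x = 0 := by
  refine intervalIntegral.integral_zero_ae (ae_of_all _ fun t ht => zeroExtFun_of_notMem fun h => ?_)
  rcases mem_uIoc.1 ht with ht | ht <;> linarith [ht.1, ht.2, h.1]

theorem primitive_neg (y : Lp01 𝕜 p) (x : ℝ) :
    primitive (-y : Lp01 𝕜 p) x = -primitive y x := by
  rw [primitive, primitive, ← intervalIntegral.integral_neg]
  refine intervalIntegral.integral_congr_ae ?_
  filter_upwards [zeroExtFun_congr (Lp.coeFn_neg y)] with t ht _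
  rw [ht]
  by_cases h : t ∈ Ioo (0 : ℝ) 1
  · simp [zeroExtFun_of_mem h]
  · simp [zeroExtFun_of_notMem h]

theorem coeFn_sum_smul (a : J → 𝕜) (v : J → Lp01 𝕜 p) :
    (∑ k, a k • v k : Lp01 𝕜 p) =ᵐ[unitMeasure] fun x => ∑ k, a k * v k x := by
  have h2 : ∀ᵐ x ∂unitMeasure, ∀ k, (a k • v k : Lp01 𝕜 p) x = a k * v k x :=
    ae_all_iff.2 fun k => Lp.coeFn_smul _ _
  filter_upwards [h2, Lp.coeFn_fun_finsetSum Finset.univ fun k => a k • v k] with x h2 h3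
  rw [h3]
  exact Finset.sum_congr rfl fun k _ => h2 k

variable [Fact (1 ≤ p)]

theorem integral_zeroExtFun_eq_sub (y : Lp01 𝕜 p) (a b : ℝ) :
    ∫ t in a..b, zeroExtFun y t = primitive y b - primitive y a := by
  have h : ∀ c d, IntervalIntegrable (zeroExtFun y) volume c d := fun c d =>
    (integrable_zeroExtFun y).intervalIntegrable
  exact (intervalIntegral.integral_interval_sub_left (h _ _) (h _ _)).symm

theorem primitive_of_one_le (y : Lp01 𝕜 p) {x : ℝ} (hx : 1 ≤ x) :
    primitive y x = primitive y 1 := by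
  rw [← sub_eq_zero, ← integral_zeroExtFun_eq_sub]
  refine intervalIntegral.integral_zero_ae (ae_of_all _ fun t ht => zeroExtFun_of_notMem fun h => ?_)
  rw [uIoc_of_le hx] at ht
  linarith [ht.1, h.2]

variable [DecidableEq J]

theorem coeFn_flow_sub (B : Matrix J J 𝕜) {h : ℝ} (h0 : 0 ≤ h) (h1 : h ≤ 1) (w : J → Lp01 𝕜 p)
    (j : J) :
    (flow p B h.toNNReal w - w) j =ᵐ[unitMeasure] fun x =>
      zeroExtFun (w j) (x - h) + ∑ k, B j k * zeroExtFun (w k) (x - (h - 1)) - w j x := by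
  rw [flow_apply_of_le_one B (Real.toNNReal_le_one.2 h1), Real.coe_toNNReal h h0, Pi.sub_apply,
    Pi.add_apply, shiftPi_apply]
  filter_upwards [Lp.coeFn_sub (shift 𝕜 p h (w j) + matAct p B (shiftPi 𝕜 p J (h - 1) w) j) (w j),
    Lp.coeFn_add (shift 𝕜 p h (w j)) (matAct p B (shiftPi 𝕜 p J (h - 1) w) j),
    coeFn_shift h (w j), coeFn_matAct_shiftPi B (h - 1) w j] with x e1 e2 e3 e4
  rw [e1, Pi.sub_apply, e2, Pi.add_apply, e3, e4]
  rfl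

/-- Integrate the two-term form of the flow; replacing r - 1 by r moves the boundary term to the
interval (-1, h - 1). -/
theorem coeFn_integral_flow (hp : p ≠ ⊤) (B : Matrix J J 𝕜) {h : ℝ} (h0 : 0 ≤ h) (h1 : h ≤ 1)
    (y : J → Lp01 𝕜 p) (j : J) :
    (∫ r in (0 : ℝ)..h, flow p B r.toNNReal y) j =ᵐ[unitMeasure] fun x =>
      primitive (y j) x - primitive (y j) (x - h) +
        ∑ k, B j k * (primitive (y k) (x + 1) - primitive (y k) (x - (h - 1))) := by
  have e : (∫ r in (0 : ℝ)..h, flow p B r.toNNReal y) j =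
      (∫ r in (0 : ℝ)..h, shift 𝕜 p r (y j)) +
        ∑ k, B j k • ∫ r in (-1 : ℝ)..(h - 1), shift 𝕜 p r (y k) := by
    have hc := (isC0Semigroup_flow hp B).continuous_orbit_toNNReal y
    have e1 := (ContinuousLinearMap.proj (R := ℝ) (φ := fun _ : J => Lp01 𝕜 p) j)
      |>.intervalIntegral_comp_comm (hc.intervalIntegrable (μ := volume) 0 h)
    refine e1.symm.trans ?_
    have e2 : ∀ r ∈ uIcc 0 h, (ContinuousLinearMap.proj (R := ℝ) (φ := fun _ : J => Lp01 𝕜 p) j)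
        (flow p B r.toNNReal y) =
          shift 𝕜 p r (y j) + ∑ k, B j k • shift 𝕜 p (r - 1) (y k) := by
      intro r hr
      rw [uIcc_of_le h0] at hr
      rw [flow_apply_of_le_one B (Real.toNNReal_le_one.2 (hr.2.trans h1)),
        Real.coe_toNNReal r hr.1, ContinuousLinearMap.proj_apply, Pi.add_apply, matAct_apply]
      rfl
    rw [intervalIntegral.integral_congr e2]
    have c1 : ∀ k, Continuous fun r : ℝ => B j k • shift 𝕜 p (r - 1) (y k) := fun k =>
      ((continuous_shift hp (y k)).comp (by fun_prop : Continuous fun r : ℝ => r - 1)).const_smul (B j k)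
    rw [intervalIntegral.integral_add ((continuous_shift hp (y j)).intervalIntegrable _ _)
      ((continuous_finsetSum _ fun k _ => c1 k).intervalIntegrable _ _),
      intervalIntegral.integral_finsetSum fun k _ => (c1 k).intervalIntegrable _ _]
    congr 1
    refine Finset.sum_congr rfl fun k _ => ?_
    rw [intervalIntegral.integral_smul,
      intervalIntegral.integral_comp_sub_right (fun r => shift 𝕜 p r (y k)), zero_sub]
  rw [e]
  have h3 : ∀ᵐ x ∂unitMeasure, ∀ k, (∫ r in (-1 : ℝ)..(h - 1), shift 𝕜 p r (y k) : Lp01 𝕜 p) x =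
      ∫ r in (x - (h - 1))..(x - (-1)), zeroExtFun (y k) r :=
    ae_all_iff.2 fun k => coeFn_integral_shift hp (by linarith) (y k)
  filter_upwards [Lp.coeFn_add (∫ r in (0 : ℝ)..h, shift 𝕜 p r (y j))
      (∑ k, B j k • ∫ r in (-1 : ℝ)..(h - 1), shift 𝕜 p r (y k)),
    coeFn_integral_shift hp h0 (y j),
    coeFn_sum_smul (B j) fun k => ∫ r in (-1 : ℝ)..(h - 1), shift 𝕜 p r (y k), h3] with x e1 e2 e3 e4
  rw [e1, Pi.add_apply, e2, e3]
  simp only [e4, integral_zeroExtFun_eq_sub, sub_neg_eq_add, sub_zero]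

theorem hasGeneratorValue_flow_of_boundary (hp : p ≠ ⊤) (B : Matrix J J 𝕜) {w y : J → Lp01 𝕜 p}
    {F : J → ℝ → 𝕜} (hF : ∀ k, IsContRep (F k) (w k)) (hd : ∀ k, HasWeakDeriv (w k) (-y k))
    (hB : (fun j => F j 0) = B *ᵥ fun k => F k 1) :
    HasGeneratorValue (flow p B) w y := by
  refine (isC0Semigroup_flow hp B).hasGeneratorValue_of_sub_eq_integral fun h h0 h1 => ?_
  have hFp : ∀ k, ∀ x ∈ Icc (0 : ℝ) 1, F k x = F k 0 - primitive (y k) x := fun k x hx => by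
    rw [(hd k).eq_add_integral (hF k) hx, sub_eq_add_neg, ← primitive_neg]
    rfl
  have hw : ∀ᵐ x ∂unitMeasure, ∀ k, zeroExtFun (w k) x = zeroExtFun (F k) x :=
    ae_all_iff.2 fun k => ae_restrict_of_ae (zeroExtFun_congr (hF k).2)
  have hwv : ∀ s : ℝ, ∀ᵐ x ∂unitMeasure, ∀ k,
      zeroExtFun (w k) (x - s) = zeroExtFun (F k) (x - s) := fun s =>
    ae_all_iff.2 fun k => ae_restrict_of_ae
      ((measurePreserving_sub_right (volume : Measure ℝ) s).quasiMeasurePreserving.ae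
        (zeroExtFun_congr (hF k).2))
  have hne : ∀ᵐ x ∂unitMeasure, x ≠ h := ae_restrict_of_ae (Measure.ae_ne volume h)
  funext j
  refine Lp.ext ?_
  filter_upwards [coeFn_flow_sub B h0.le h1.le w j, coeFn_integral_flow hp B h0.le h1.le y j, hwv h,
    hwv (h - 1), hne, (hF j).2, ae_restrict_mem measurableSet_Ioo] with x e1 e2 e3 e4 e5 e6 hx
  rw [e1, e2, e6]
  simp only [e3, e4]
  have hBj : F j 0 = ∑ k, B j k * F k 1 := congrFun hB j
  have p1 : ∀ k, primitive (y k) (x + 1) = primitive (y k) 1 := fun k =>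
    primitive_of_one_le _ (by linarith [hx.1])
  -- For x < h the value at x has entered through the boundary, and only the term with B survives;
  -- the boundary condition rewrites F_j(0). For x > h the value comes from the interior and that
  -- term vanishes.
  rcases lt_or_gt_of_ne e5 with hxh | hxh
  · rw [zeroExtFun_of_notMem (fun h' => by linarith [h'.1]),
      primitive_of_nonpos _ (by linarith : x - h ≤ 0), hFp j x ⟨hx.1.le, hx.2.le⟩, hBj, zero_add,
      sub_zero, sub_sub_eq_add_sub, add_sub_right_comm, ← Finset.sum_sub_distrib, add_comm]
    congr 1
    refine Finset.sum_congr rfl fun k _ => ?_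
    have hm : x - (h - 1) ∈ Ioo (0 : ℝ) 1 := ⟨by linarith [hx.1], by linarith⟩
    rw [zeroExtFun_of_mem hm, hFp k _ ⟨hm.1.le, hm.2.le⟩, hFp k 1 ⟨zero_le_one, le_rfl⟩, p1]
    ring
  · have hm : x - h ∈ Ioo (0 : ℝ) 1 := ⟨by linarith, by linarith [hx.2]⟩
    have z1 : ∀ k, zeroExtFun (F k) (x - (h - 1)) = 0 := fun k =>
      zeroExtFun_of_notMem fun h' => by linarith [h'.2]
    have z2 : ∀ k, primitive (y k) (x - (h - 1)) = primitive (y k) 1 := fun k =>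
      primitive_of_one_le _ (by linarith)
    simp only [z1, z2, p1, sub_self, mul_zero, Finset.sum_const_zero, add_zero]
    rw [zeroExtFun_of_mem hm, hFp j _ ⟨hm.1.le, hm.2.le⟩, hFp j x ⟨hx.1.le, hx.2.le⟩]
    ring

/-- Here the increment falls on φ, whose Lipschitz constant gives the dominating function C‖u‖; no
regularity of u is needed. -/
theorem tendsto_integral_slope_smul {φ : ℝ → ℝ} (h1 : ContDiff ℝ ∞ φ) (h2 : HasCompactSupport φ)
    {u : ℝ → 𝕜} (hu : Integrable u) :
    Tendsto (fun h : ℝ => h⁻¹ • ((∫ x, φ (x + h) • u x) - ∫ x, φ x • u x)) (𝓝[>] 0)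
      (𝓝 (∫ x, deriv φ x • u x)) := by
  obtain ⟨C, hC⟩ := h1.lipschitzWith_of_hasCompactSupport h2 (by simp)
  have hm : ∀ h : ℝ, AEStronglyMeasurable (fun x => φ (x + h) • u x) volume := fun h =>
    (h1.continuous.comp (by fun_prop : Continuous fun x : ℝ => x + h)).aestronglyMeasurable.smul hu.1
  obtain ⟨K, hK⟩ := h2.exists_bound_of_continuous h1.continuous
  have key := hasDerivAt_integral_of_dominated_loc_of_lip (μ := volume) (x₀ := (0 : ℝ))
    (s := univ) (F := fun h x => φ (x + h) • u x) (F' := fun x => deriv φ x • u x)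
    (bound := fun x => C * ‖u x‖) univ_mem (Eventually.of_forall hm)
    (hu.bdd_smul K (h1.continuous.comp
      (by fun_prop : Continuous fun x : ℝ => x + 0)).aestronglyMeasurable
      (ae_of_all _ fun x => hK _))
    ((h1.continuous_deriv (by simp)).aestronglyMeasurable.smul hu.1)
    (ae_of_all _ fun x => ?_) (hu.norm.const_mul _) (ae_of_all _ fun x => ?_)
  · have h3 := hasDerivAt_iff_tendsto_slope_zero.1 key.2
    refine (h3.mono_left (nhdsWithin_mono _ fun z (hz : 0 < z) => hz.ne')).congr fun t => ?_
    simp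
  · refine LipschitzOnWith.of_dist_le_mul fun a _ b _ => ?_
    rw [dist_eq_norm, ← sub_smul, norm_smul, Real.coe_nnabs, abs_of_nonneg (by positivity),
      mul_right_comm]
    refine mul_le_mul_of_nonneg_right ?_ (norm_nonneg _)
    rw [← dist_eq_norm]
    refine (hC.dist_le_mul _ _).trans (le_of_eq ?_)
    simp
  · have h3 : HasDerivAt φ (deriv φ (x + 0)) (x + 0) :=
      (h1.differentiable (by simp)).differentiableAt.hasDerivAt
    have h4 := (h3.comp_const_add x 0).smul_const (u x)
    simpa using h4

theorem HasGeneratorValue.hasWeakDeriv_flow {B : Matrix J J 𝕜} {w y : J → Lp01 𝕜 p}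
    (hw : HasGeneratorValue (flow p B) w y) (j : J) : HasWeakDeriv (w j) (-y j) := by
  intro φ h1 h2 h3
  obtain ⟨C, hC⟩ := h2.exists_bound_of_continuous h1.continuous
  obtain ⟨a, b, ha, hb, hab⟩ := exists_Icc_of_tsupport_subset h2 h3
  have hz : ∀ x, x ∉ Icc a b → φ x = 0 := fun x hx =>
    image_eq_zero_of_notMem_tsupport fun h => hx (hab h)
  have hI : ∀ (ψ : ℝ → ℝ) (u : ℝ → 𝕜),
      ∫ x in Ioo (0 : ℝ) 1, ψ x • u x = ∫ x, ψ x • zeroExtFun u x := fun ψ u => by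
    rw [← integral_indicator measurableSet_Ioo]
    refine integral_congr_ae (ae_of_all _ fun x => ?_)
    by_cases hx : x ∈ Ioo (0 : ℝ) 1
    · simp only [indicator_of_mem hx, zeroExtFun_of_mem hx]
    · simp only [indicator_of_notMem hx, zeroExtFun_of_notMem hx, smul_zero]
  set ℓ := (pairing (𝕜 := 𝕜) (p := p) φ h1.continuous.measurable C hC).comp
    (ContinuousLinearMap.proj (R := ℝ) (φ := fun _ : J => Lp01 𝕜 p) j) with hℓ
  have hℓa : ∀ v : J → Lp01 𝕜 p, ℓ v = ∫ x in Ioo (0 : ℝ) 1, φ x • v j x := fun v => rfl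
  have t1 := (ℓ.continuous.tendsto y).comp (hasGeneratorValue_iff_real.1 hw)
  have t2 := tendsto_integral_slope_smul h1 h2 (integrable_zeroExtFun (w j))
  have e : (fun h : ℝ => ℓ (h⁻¹ • (flow p B h.toNNReal w - w))) =ᶠ[𝓝[>] 0]
      fun h : ℝ => h⁻¹ • ((∫ x, φ (x + h) • zeroExtFun (w j) x) -
        ∫ x, φ x • zeroExtFun (w j) x) := by
    -- h < 1 allows the two-term form. h < a keeps the inflow through 0 away from the support of φ,
    -- so B plays no role here.
    filter_upwards [Ioo_mem_nhdsGT (lt_min ha one_pos)] with h hh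
    have hha : h < a := hh.2.trans_le (min_le_left _ _)
    rw [_root_.map_smul, hℓa]
    congr 1
    have i1 : Integrable (fun x => φ x • zeroExtFun (w j) (x - h)) :=
      ((integrable_zeroExtFun (w j)).comp_sub_right h).bdd_smul C
        h1.continuous.aestronglyMeasurable (ae_of_all _ hC)
    have i2 : Integrable (fun x => φ x • zeroExtFun (w j) x) :=
      (integrable_zeroExtFun (w j)).bdd_smul C
        h1.continuous.aestronglyMeasurable (ae_of_all _ hC)
    have e1 : ∫ x, φ (x + h) • zeroExtFun (w j) x = ∫ x, φ x • zeroExtFun (w j) (x - h) := by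
      rw [← integral_sub_right_eq_self _ h]
      simp
    have e3 := setIntegral_eq_integral_of_forall_compl_eq_zero (μ := volume)
      (s := Ioo (0 : ℝ) 1) (f := fun x => φ x • zeroExtFun (w j) (x - h) - φ x • zeroExtFun (w j) x)
      (fun x hx => by simp [hz x fun h => hx (Icc_subset_Ioo ha hb h)])
    rw [e1, ← integral_sub i1 i2, ← e3]
    refine integral_congr_ae ?_
    filter_upwards [coeFn_flow_sub B hh.1.le (hh.2.le.trans (min_le_right _ _)) w j,
      ae_restrict_mem measurableSet_Ioo] with x hx hx01
    rw [hx]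
    by_cases hxa : x ∈ Icc a b
    · have z : ∀ k, zeroExtFun (w k) (x - (h - 1)) = 0 := fun k =>
        zeroExtFun_of_notMem fun h' => by linarith [h'.2, hxa.1]
      simp only [z, mul_zero, Finset.sum_const_zero, add_zero, smul_sub, zeroExtFun_of_mem hx01]
    · simp [hz x hxa]
  have e2 := tendsto_nhds_unique (t1.congr' e) t2
  rw [hℓa] at e2
  rw [hI, ← e2, ← integral_neg]
  refine integral_congr_ae ?_
  filter_upwards [Lp.coeFn_neg (y j)] with x hx
  rw [hx, Pi.neg_apply, smul_neg, neg_neg]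

/-- In the integral identity at time 1/2, a point x < 1/2 sees only inflow. Writing each F_k through
the primitive of y_k cancels all dependence on x and leaves F_j(0) = Σ B_jk F_k(1). -/
theorem HasGeneratorValue.boundary_flow (hp : p ≠ ⊤) {B : Matrix J J 𝕜} {w y : J → Lp01 𝕜 p}
    (hw : HasGeneratorValue (flow p B) w y) {F : J → ℝ → 𝕜} (hF : ∀ k, IsContRep (F k) (w k)) :
    (fun j => F j 0) = B *ᵥ fun k => F k 1 := by
  have hFp : ∀ k, ∀ x ∈ Icc (0 : ℝ) 1, F k x = F k 0 - primitive (y k) x := fun k x hx => by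
    rw [(hw.hasWeakDeriv_flow k).eq_add_integral (hF k) hx, sub_eq_add_neg, ← primitive_neg]
    rfl
  have hid := hw.sub_eq_integral (isC0Semigroup_flow hp B) (s := 1 / 2) (by norm_num)
  funext j
  have hwv : ∀ᵐ x ∂unitMeasure, ∀ k,
      zeroExtFun (w k) (x - (1 / 2 - 1)) = zeroExtFun (F k) (x - (1 / 2 - 1)) :=
    ae_all_iff.2 fun k => ae_restrict_of_ae
      ((measurePreserving_sub_right (volume : Measure ℝ) _).quasiMeasurePreserving.ae
        (zeroExtFun_congr (hF k).2))
  have e2 := coeFn_integral_flow hp B (h := 1 / 2) (by norm_num) (by norm_num) y j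
  rw [← hid] at e2
  have hae : ∀ᵐ x ∂unitMeasure, x < 1 / 2 → F j 0 = (B *ᵥ fun k => F k 1) j := by
    filter_upwards [coeFn_flow_sub B (h := 1 / 2) (by norm_num) (by norm_num) w j, e2, hwv,
      (hF j).2, ae_restrict_mem measurableSet_Ioo] with x e1 e2 e3 e4 hx hx2
    rw [e1, e4] at e2
    have p1 : ∀ k, primitive (y k) (x + 1) = primitive (y k) 1 := fun k =>
      primitive_of_one_le _ (by linarith [hx.1])
    have hm : x - (1 / 2 - 1) ∈ Ioo (0 : ℝ) 1 := ⟨by linarith [hx.1], by linarith⟩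
    have z : ∀ k, zeroExtFun (F k) (x - (1 / 2 - 1)) =
        F k 1 + (primitive (y k) 1 - primitive (y k) (x - (1 / 2 - 1))) := fun k => by
      rw [zeroExtFun_of_mem hm, hFp k _ ⟨hm.1.le, hm.2.le⟩, hFp k 1 ⟨zero_le_one, le_rfl⟩]
      ring
    simp only [e3, z, p1, mul_add, Finset.sum_add_distrib] at e2
    rw [zeroExtFun_of_notMem (fun h' => by linarith [h'.1]),
      primitive_of_nonpos _ (by linarith : x - 1 / 2 ≤ 0), hFp j x ⟨hx.1.le, hx.2.le⟩] at e2
    rw [Matrix.mulVec, dotProduct]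
    linear_combination -e2
  -- The equation does not involve x, so its validity almost everywhere on a set of positive measure
  -- suffices.
  by_contra hne
  have h0 := (ae_restrict_iff' measurableSet_Ioo).1 hae
  have h3 : volume (Ioo (0 : ℝ) (1 / 2)) = 0 := by
    refine measure_mono_null (fun x hx => ?_) h0
    intro h
    exact hne (h ⟨hx.1, by linarith [hx.2]⟩ hx.2)
  simp at h3

end FlowGenerator

/-! ### Reflection of the left-moving components -/

section Reflection

variable {𝕜 : Type*} [RCLike 𝕜] {p : ℝ≥0∞} [Fact (1 ≤ p)]

theorem measurePreserving_one_sub :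
    MeasurePreserving (fun x : ℝ => 1 - x) unitMeasure unitMeasure := by
  have h := (Measure.measurePreserving_sub_left (volume : Measure ℝ) 1).restrict_preimage
    (measurableSet_Ioo (a := (0 : ℝ)) (b := 1))
  rwa [preimage_const_sub_Ioo, sub_self, sub_zero] at h

theorem measurableEmbedding_one_sub : MeasurableEmbedding fun x : ℝ => 1 - x :=
  (Homeomorph.subLeft (1 : ℝ)).measurableEmbedding

theorem ae_one_sub {P : ℝ → Prop} (h : ∀ᵐ x ∂unitMeasure, P x) : ∀ᵐ x ∂unitMeasure, P (1 - x) :=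
  measurePreserving_one_sub.quasiMeasurePreserving.ae h

variable (𝕜 p) in
/-- The reflection `f ↦ f(1 - ·)` of `L^p(0,1)`. -/
def reflect : Lp01 𝕜 p →L[𝕜] Lp01 𝕜 p :=
  (Lp.compMeasurePreservingₗᵢ 𝕜 (fun x : ℝ => 1 - x)
    measurePreserving_one_sub).toContinuousLinearMap

theorem coeFn_reflect (f : Lp01 𝕜 p) : reflect 𝕜 p f =ᵐ[unitMeasure] fun x => f (1 - x) :=
  Lp.coeFn_compMeasurePreserving f measurePreserving_one_sub

theorem reflect_reflect (f : Lp01 𝕜 p) : reflect 𝕜 p (reflect 𝕜 p f) = f := by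
  refine Lp.ext ?_
  filter_upwards [coeFn_reflect (reflect 𝕜 p f), ae_one_sub (coeFn_reflect f)] with x h1 h2
  rw [h1, h2, sub_sub_cancel]

theorem IsContRep.reflect {F : ℝ → 𝕜} {f : Lp01 𝕜 p} (h : IsContRep F f) :
    IsContRep (fun x => F (1 - x)) (reflect 𝕜 p f) := by
  refine ⟨h.1.comp (by fun_prop) fun x hx => ⟨by linarith [hx.2], by linarith [hx.1]⟩, ?_⟩
  filter_upwards [coeFn_reflect f, ae_one_sub h.2] with x h1 h2
  rw [h1, h2]

theorem HasWeakDeriv.reflect {f g : Lp01 𝕜 p} (h : HasWeakDeriv f g) :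
    HasWeakDeriv (reflect 𝕜 p f) (-reflect 𝕜 p g) := by
  intro φ h1 h2 h3
  have hsubst : ∀ (ψ : ℝ → ℝ) (u : Lp01 𝕜 p), ∫ x in Ioo (0 : ℝ) 1, ψ x • PortHam.reflect 𝕜 p u x =
      ∫ x in Ioo (0 : ℝ) 1, ψ (1 - x) • u x := by
    intro ψ u
    have := measurePreserving_one_sub.integral_comp measurableEmbedding_one_sub
      fun x => ψ (1 - x) • u x
    rw [← this]
    refine integral_congr_ae ?_
    filter_upwards [coeFn_reflect u] with x hx
    rw [hx, sub_sub_cancel]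
  have hts : tsupport (fun x => φ (1 - x)) ⊆ Ioo (0 : ℝ) 1 := by
    refine (tsupport_comp_subset_preimage φ (by fun_prop : Continuous fun x : ℝ => 1 - x)).trans ?_
    intro x hx
    have := h3 hx
    exact ⟨by linarith [this.2], by linarith [this.1]⟩
  have e := h (fun x => φ (1 - x)) (h1.comp (by fun_prop))
    (h2.comp_homeomorph (Homeomorph.subLeft (1 : ℝ))) hts
  have hd : deriv (fun x => φ (1 - x)) = fun x => -deriv φ (1 - x) :=
    funext fun x => _root_.deriv_comp_const_sub φ 1 x
  have hn : ∫ x in Ioo (0 : ℝ) 1, φ x • (-PortHam.reflect 𝕜 p g : Lp01 𝕜 p) x =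
      -∫ x in Ioo (0 : ℝ) 1, φ x • PortHam.reflect 𝕜 p g x := by
    rw [← integral_neg]
    refine integral_congr_ae ?_
    filter_upwards [Lp.coeFn_neg (PortHam.reflect 𝕜 p g)] with x hx
    rw [hx, Pi.neg_apply, smul_neg]
  rw [hn, hsubst, hsubst, neg_neg]
  rw [hd] at e
  simp only [neg_smul, integral_neg, neg_inj] at e
  exact e

theorem hasWeakDeriv_reflect_iff {f g : Lp01 𝕜 p} :
    HasWeakDeriv (reflect 𝕜 p f) (-reflect 𝕜 p g) ↔ HasWeakDeriv f g := by
  refine ⟨fun h => ?_, HasWeakDeriv.reflect⟩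
  have := h.reflect
  rwa [_root_.map_neg, neg_neg, reflect_reflect, reflect_reflect] at this

end Reflection

/-! ### The semigroup of the system -/

section Solution

variable {𝕜 : Type*} [RCLike 𝕜] {p : ℝ≥0∞} [Fact (1 ≤ p)] {Jp Jm : Type*}

variable (𝕜 p Jp Jm) in
/-- The reflection of the components of index in `Jm`. -/
def orient (j : Jp ⊕ Jm) : Lp01 𝕜 p →L[𝕜] Lp01 𝕜 p :=
  Sum.elim (fun _ => ContinuousLinearMap.id 𝕜 _) (fun _ => reflect 𝕜 p) j

theorem orient_orient (j : Jp ⊕ Jm) (f : Lp01 𝕜 p) :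
    orient 𝕜 p Jp Jm j (orient 𝕜 p Jp Jm j f) = f := by
  rcases j with j | j
  · rfl
  · exact reflect_reflect f

variable (𝕜 p Jp Jm) in
/-- The state with all components transported to the right. -/
def toRight : StateSpace 𝕜 p Jp Jm →L[𝕜] (Jp ⊕ Jm → Lp01 𝕜 p) :=
  ContinuousLinearMap.pi fun j => (orient 𝕜 p Jp Jm j).comp (PiLp.proj p _ j)

variable (𝕜 p Jp Jm) in
/-- The inverse of `toRight`. -/
def ofRight : (Jp ⊕ Jm → Lp01 𝕜 p) →L[𝕜] StateSpace 𝕜 p Jp Jm :=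
  ((PiLp.continuousLinearEquiv p 𝕜 fun _ : Jp ⊕ Jm => Lp01 𝕜 p).symm :
    (Jp ⊕ Jm → Lp01 𝕜 p) →L[𝕜] StateSpace 𝕜 p Jp Jm).comp
    (ContinuousLinearMap.pi fun j => (orient 𝕜 p Jp Jm j).comp (ContinuousLinearMap.proj j))

theorem toRight_apply (Φ : StateSpace 𝕜 p Jp Jm) (j : Jp ⊕ Jm) :
    toRight 𝕜 p Jp Jm Φ j = orient 𝕜 p Jp Jm j (Φ j) := rfl

theorem ofRight_apply (w : Jp ⊕ Jm → Lp01 𝕜 p) (j : Jp ⊕ Jm) :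
    ofRight 𝕜 p Jp Jm w j = orient 𝕜 p Jp Jm j (w j) := rfl

theorem toRight_ofRight (w : Jp ⊕ Jm → Lp01 𝕜 p) :
    toRight 𝕜 p Jp Jm (ofRight 𝕜 p Jp Jm w) = w :=
  funext fun j => by rw [toRight_apply, ofRight_apply, orient_orient]

theorem ofRight_toRight (Φ : StateSpace 𝕜 p Jp Jm) :
    ofRight 𝕜 p Jp Jm (toRight 𝕜 p Jp Jm Φ) = Φ :=
  PiLp.ext fun j => by rw [ofRight_apply, toRight_apply, orient_orient]

variable [Fintype Jp] [Fintype Jm]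

/-- Supplies the coverage needed for uniqueness: for almost every x some n prescribes the value
there. Applied at 1 - x it serves the left-moving components. -/
theorem ae_exists_nat (t : ℝ≥0) :
    ∀ᵐ x ∂unitMeasure, ∃ n : ℕ, (n : ℝ) - 1 + x < t ∧ (t : ℝ) < n + x := by
  filter_upwards [ae_unitMeasure_fract_sub (P := fun _ => True) (by simp) (t : ℝ),
    ae_restrict_mem measurableSet_Ioo] with x h hx
  have hfl : ⌊x - t⌋ ≤ 0 := by
    have : ⌊x - t⌋ < 1 := Int.floor_lt.2 (by push_cast; linarith [hx.2, t.2])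
    omega
  have e : (((-⌊x - t⌋).toNat : ℕ) : ℝ) = -(⌊x - t⌋ : ℝ) := by
    have : (((-⌊x - t⌋).toNat : ℕ) : ℤ) = -⌊x - t⌋ := Int.toNat_of_nonneg (by omega)
    exact_mod_cast this
  have h1 := h.1
  have h2 := Int.fract_lt_one (x - t)
  rw [Int.fract] at h1 h2
  exact ⟨_, by rw [e]; linarith, by rw [e]; linarith⟩

theorem weakDeriv_eq_iff {f g : Lp01 𝕜 p} (hf : f ∈ W1p 𝕜 p) :
    weakDeriv ⟨f, hf⟩ = g ↔ HasWeakDeriv f g :=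
  ⟨fun h => h ▸ Classical.choose_spec hf, fun h => (Classical.choose_spec hf).unique h⟩

theorem operatorA_eq_iff {B : Matrix (Jp ⊕ Jm) (Jp ⊕ Jm) 𝕜} {Φ Ψ : StateSpace 𝕜 p Jp Jm} :
    (∃ h : Φ ∈ (operatorA p B).domain, operatorA p B ⟨Φ, h⟩ = Ψ) ↔
      ((∀ j, HasWeakDeriv (Φ (Sum.inl j)) (-Ψ (Sum.inl j))) ∧
        ∀ j, HasWeakDeriv (Φ (Sum.inr j)) (Ψ (Sum.inr j))) ∧
      ∃ F : Jp ⊕ Jm → ℝ → 𝕜, (∀ j, IsContRep (F j) (Φ j)) ∧ BoundaryCondition B F := by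
  constructor
  · rintro ⟨h, rfl⟩
    refine ⟨⟨fun j => ?_, fun j => ?_⟩, h.2⟩
    · have : operatorA p B ⟨Φ, h⟩ (Sum.inl j) = -weakDeriv ⟨Φ (Sum.inl j), h.1 (Sum.inl j)⟩ := rfl
      rw [this, neg_neg]
      exact (weakDeriv_eq_iff _).1 rfl
    · exact (weakDeriv_eq_iff (h.1 (Sum.inr j))).1 rfl
  · rintro ⟨⟨h1, h2⟩, h3⟩
    have hW : ∀ j, Φ j ∈ W1p 𝕜 p := by
      rintro (j | j)
      · exact ⟨_, h1 j⟩
      · exact ⟨_, h2 j⟩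
    refine ⟨⟨hW, h3⟩, PiLp.ext ?_⟩
    rintro (j | j)
    · exact neg_eq_iff_eq_neg.2 ((weakDeriv_eq_iff (hW _)).2 (h1 j))
    · exact (weakDeriv_eq_iff (hW _)).2 (h2 j)

variable [DecidableEq Jp] [DecidableEq Jm]

variable (p) in
/-- The family of operators given by the method of characteristics. -/
def characteristicsFamily (B : Matrix (Jp ⊕ Jm) (Jp ⊕ Jm) 𝕜) (t : ℝ≥0) :
    StateSpace 𝕜 p Jp Jm →L[𝕜] StateSpace 𝕜 p Jp Jm :=
  (ofRight 𝕜 p Jp Jm).comp ((flow p B t).comp (toRight 𝕜 p Jp Jm))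

theorem characteristicsFamily_apply (B : Matrix (Jp ⊕ Jm) (Jp ⊕ Jm) 𝕜) (t : ℝ≥0)
    (Φ : StateSpace 𝕜 p Jp Jm) : characteristicsFamily p B t Φ =
      ofRight 𝕜 p Jp Jm (flow p B t (toRight 𝕜 p Jp Jm Φ)) := rfl

theorem isC0Semigroup_characteristicsFamily (hp : p ≠ ⊤) (B : Matrix (Jp ⊕ Jm) (Jp ⊕ Jm) 𝕜) :
    IsC0Semigroup (characteristicsFamily p B) where
  map_zero := ContinuousLinearMap.ext fun Φ => by
    rw [characteristicsFamily_apply, (isC0Semigroup_flow hp B).apply_zero, ofRight_toRight]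
    rfl
  map_add s t := ContinuousLinearMap.ext fun Φ => by
    rw [ContinuousLinearMap.comp_apply, characteristicsFamily_apply, characteristicsFamily_apply,
      characteristicsFamily_apply, toRight_ofRight, (isC0Semigroup_flow hp B).apply_add]
  continuous_orbit Φ := (ofRight 𝕜 p Jp Jm).continuous.comp
    ((isC0Semigroup_flow hp B).continuous_orbit (toRight 𝕜 p Jp Jm Φ))

theorem hasGeneratorValue_characteristicsFamily_iff {B : Matrix (Jp ⊕ Jm) (Jp ⊕ Jm) 𝕜}
    {Φ Ψ : StateSpace 𝕜 p Jp Jm} : HasGeneratorValue (characteristicsFamily p B) Φ Ψ ↔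
      HasGeneratorValue (flow p B) (toRight 𝕜 p Jp Jm Φ) (toRight 𝕜 p Jp Jm Ψ) := by
  constructor
  · intro h
    refine (((toRight 𝕜 p Jp Jm).continuous.tendsto Ψ).comp h).congr fun r => ?_
    rw [Function.comp_apply, _root_.map_smul, _root_.map_sub, characteristicsFamily_apply,
      toRight_ofRight]
  · intro h
    have h' := ((ofRight 𝕜 p Jp Jm).continuous.tendsto (toRight 𝕜 p Jp Jm Ψ)).comp h
    rw [ofRight_toRight] at h'
    refine h'.congr fun r => ?_
    rw [Function.comp_apply, _root_.map_smul, _root_.map_sub, ofRight_toRight,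
      characteristicsFamily_apply]

theorem ae_flow_toRight (B : Matrix (Jp ⊕ Jm) (Jp ⊕ Jm) 𝕜) (t : ℝ≥0)
    (Φ : StateSpace 𝕜 p Jp Jm) : ∀ᵐ x ∂unitMeasure, ∀ n : ℕ,
      (n : ℝ) - 1 + x < t → (t : ℝ) < n + x →
        (fun j => flow p B t (toRight 𝕜 p Jp Jm Φ) j x) =
          B ^ n *ᵥ Sum.elim (fun k => Φ (Sum.inl k) (n - t + x))
            (fun k => Φ (Sum.inr k) (1 - n + t - x)) := by
  have h2 : ∀ᵐ y ∂unitMeasure, ∀ k, toRight 𝕜 p Jp Jm Φ (Sum.inr k) y = Φ (Sum.inr k) (1 - y) :=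
    ae_all_iff.2 fun k => coeFn_reflect (Φ (Sum.inr k))
  filter_upwards [coeFn_flow B t (toRight 𝕜 p Jp Jm Φ), ae_unitMeasure_fract_sub h2 (t : ℝ)]
    with x h1 h2 n hn1 hn2
  have e : x - t + n = Int.fract (x - t) := by
    have : ⌊x - t⌋ = -(n : ℤ) := by
      rw [Int.floor_eq_iff]
      push_cast
      constructor <;> linarith
    rw [Int.fract, this]
    push_cast
    ring
  rw [← e] at h2
  rw [funext h1]
  refine (leftExt_of_mem B _ (by linarith) (by linarith)).trans ?_
  congr 1
  funext k
  rcases k with k | k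
  · rw [Sum.elim_inl, (by ring : (n : ℝ) - t + x = x - t + n)]
    rfl
  · rw [Sum.elim_inr, h2.2 k, (by ring : (1 : ℝ) - n + t - x = 1 - (x - t + n))]

theorem mulVec_sumElim {m n : Type*} [Fintype m] [Fintype n] (M : Matrix (m ⊕ n) (m ⊕ n) 𝕜)
    (a : m → 𝕜) (b : n → 𝕜) : M *ᵥ Sum.elim a b =
      Sum.elim (M.toBlocks₁₁ *ᵥ a + M.toBlocks₁₂ *ᵥ b) (M.toBlocks₂₁ *ᵥ a + M.toBlocks₂₂ *ᵥ b) := by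
  conv_lhs => rw [← M.fromBlocks_toBlocks, Matrix.fromBlocks_mulVec]
  rfl

theorem isCharacteristicsFamily_characteristicsFamily (B : Matrix (Jp ⊕ Jm) (Jp ⊕ Jm) 𝕜) :
    IsCharacteristicsFamily B (characteristicsFamily p B) := by
  intro t Φ
  have hr : ∀ᵐ x ∂unitMeasure, ∀ j : Jm, characteristicsFamily p B t Φ (Sum.inr j) x =
      flow p B t (toRight 𝕜 p Jp Jm Φ) (Sum.inr j) (1 - x) :=
    ae_all_iff.2 fun j => coeFn_reflect (flow p B t (toRight 𝕜 p Jp Jm Φ) (Sum.inr j))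
  filter_upwards [ae_flow_toRight B t Φ, ae_one_sub (ae_flow_toRight B t Φ), hr]
    with x h1 h2 h3 n
  refine ⟨fun ⟨hn1, hn2⟩ => ?_, fun ⟨hn1, hn2⟩ => ?_⟩
  · have e := h1 n hn1 hn2
    rw [mulVec_sumElim] at e
    exact funext fun j => congrFun e (Sum.inl j)
  · have e := h2 n (by linarith) (by linarith)
    rw [mulVec_sumElim, (by ring : (n : ℝ) - t + (1 - x) = 1 - t + n - x),
      (by ring : (1 : ℝ) - n + t - (1 - x) = t - n + x)] at e
    exact funext fun j => (h3 j).trans (congrFun e (Sum.inr j))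

theorem IsCharacteristicsFamily.eq {B : Matrix (Jp ⊕ Jm) (Jp ⊕ Jm) 𝕜}
    {T G : ℝ≥0 → (StateSpace 𝕜 p Jp Jm →L[𝕜] StateSpace 𝕜 p Jp Jm)}
    (hT : IsCharacteristicsFamily B T) (hG : IsCharacteristicsFamily B G) : T = G := by
  refine funext fun t => ContinuousLinearMap.ext fun Φ => PiLp.ext fun j => Lp.ext ?_
  filter_upwards [hT t Φ, hG t Φ, ae_exists_nat t, ae_one_sub (ae_exists_nat t)]
    with x h1 h2 ⟨n, hn⟩ ⟨m, hm⟩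
  rcases j with j | j
  · exact congrFun (((h1 n).1 hn).trans ((h2 n).1 hn).symm) j
  · have hm' : (m : ℝ) - x < t ∧ (t : ℝ) < m + 1 - x := ⟨by linarith [hm.1], by linarith [hm.2]⟩
    exact congrFun (((h1 m).2 hm').trans ((h2 m).2 hm').symm) j

/-- Reflection reverses the sign of the derivative and swaps the endpoints, so ϖ' becomes a
right-moving term and the boundary condition becomes w(0) = B w(1). -/
theorem hasGeneratorValue_iff_operatorA (hp : p ≠ ⊤) {B : Matrix (Jp ⊕ Jm) (Jp ⊕ Jm) 𝕜}
    {Φ Ψ : StateSpace 𝕜 p Jp Jm} : HasGeneratorValue (characteristicsFamily p B) Φ Ψ ↔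
      ∃ h : Φ ∈ (operatorA p B).domain, operatorA p B ⟨Φ, h⟩ = Ψ := by
  rw [hasGeneratorValue_characteristicsFamily_iff, operatorA_eq_iff]
  have hd : (∀ j, HasWeakDeriv (toRight 𝕜 p Jp Jm Φ j) (-toRight 𝕜 p Jp Jm Ψ j)) ↔
      (∀ j, HasWeakDeriv (Φ (Sum.inl j)) (-Ψ (Sum.inl j))) ∧
        ∀ j, HasWeakDeriv (Φ (Sum.inr j)) (Ψ (Sum.inr j)) := by
    rw [Sum.forall]
    exact and_congr Iff.rfl (forall_congr' fun j => hasWeakDeriv_reflect_iff)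
  constructor
  · intro h
    have hw := h.hasWeakDeriv_flow
    choose F hF using fun j => (hw j).exists_isContRep
    have hB := h.boundary_flow hp hF
    refine ⟨hd.1 hw, Sum.elim (fun j => F (Sum.inl j)) fun j x => F (Sum.inr j) (1 - x), ?_, ?_⟩
    · rintro (j | j)
      · exact hF (Sum.inl j)
      · have := (hF (Sum.inr j)).reflect
        rwa [show toRight 𝕜 p Jp Jm Φ (Sum.inr j) = reflect 𝕜 p (Φ (Sum.inr j)) from rfl,
          reflect_reflect] at this
    · unfold BoundaryCondition
      refine Eq.trans (funext ?_) (hB.trans (congrArg (B *ᵥ ·) (funext ?_))) <;>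
        rintro (j | j) <;> simp
  · rintro ⟨h1, F, hF, hB⟩
    refine hasGeneratorValue_flow_of_boundary hp B
      (F := Sum.elim (fun j => F (Sum.inl j)) fun j x => F (Sum.inr j) (1 - x)) ?_ (hd.2 h1) ?_
    · rintro (j | j)
      · exact hF (Sum.inl j)
      · exact (hF (Sum.inr j)).reflect
    · refine Eq.trans (funext ?_) (hB.trans (congrArg (B *ᵥ ·) (funext ?_))) <;>
        rintro (j | j) <;> simp

theorem generator_characteristicsFamily (hp : p ≠ ⊤) (B : Matrix (Jp ⊕ Jm) (Jp ⊕ Jm) 𝕜) :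
    generator (characteristicsFamily p B) = operatorA p B := by
  refine LinearPMap.eq_of_eq_graph (Submodule.ext fun q => ?_)
  have h := hasGeneratorValue_iff_operatorA hp (B := B) (Φ := q.1) (Ψ := q.2)
  rw [hasGeneratorValue_iff_generator] at h
  simp only [LinearPMap.mem_graph_iff, Subtype.exists, exists_and_left, exists_eq_left]
  exact h

end Solution

end PortHam

end

theorem theorem2 {𝕜 : Type*} [RCLike 𝕜] (p : ℝ≥0∞) [Fact (1 ≤ p)] (hp : p ≠ ⊤)
    {Jp Jm : Type*} [Fintype Jp] [DecidableEq Jp] [Fintype Jm] [DecidableEq Jm]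
    (B : Matrix (Jp ⊕ Jm) (Jp ⊕ Jm) 𝕜) :
    (∃! T : ℝ≥0 → (PortHam.StateSpace 𝕜 p Jp Jm →L[𝕜] PortHam.StateSpace 𝕜 p Jp Jm),
      PortHam.IsCharacteristicsFamily B T) ∧
    ∀ T : ℝ≥0 → (PortHam.StateSpace 𝕜 p Jp Jm →L[𝕜] PortHam.StateSpace 𝕜 p Jp Jm),
      PortHam.IsCharacteristicsFamily B T →
        PortHam.IsC0Semigroup T ∧
        PortHam.generator T = PortHam.operatorA p B ∧
        ∀ G : ℝ≥0 → (PortHam.StateSpace 𝕜 p Jp Jm →L[𝕜] PortHam.StateSpace 𝕜 p Jp Jm),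
          PortHam.IsC0Semigroup G → PortHam.generator G = PortHam.operatorA p B →
            ∀ t : ℝ≥0, T t = G t := by
  have hB := PortHam.isCharacteristicsFamily_characteristicsFamily (p := p) B
  refine ⟨⟨_, hB, fun T hT => hT.eq hB⟩, fun T hT => ?_⟩
  obtain rfl := hT.eq hB
  have h0 := PortHam.isC0Semigroup_characteristicsFamily hp B
  have hA := PortHam.generator_characteristicsFamily hp B
  exact ⟨h0, hA, fun G hG hGA => h0.eq_of_generator_eq hG (hA.trans hGA.symm)⟩
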